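/- Let $n\in\mathbb{N}$, let $\Omega$ be a $\sigma$-compact topological space with a positive regular Borel measure $\mu$, let $K:\Omega\to\mathbb{C}$ be locally integrable, and let $(A(u))_{u\in\Omega}$ be a $\mu$-measurable commuting family of self-adjoint (i.e. symmetric) real $n\times n$ matrices such that $A(u)$ is non-singular for $\mu$-almost every $u$ with $K(u)\neq 0$. Assume that $|\det A(u)|^{-1/2}K(u)\in L^1(\Omega,\mu)$. Then the Hausdorff operator $$(\mathcal{H}_{K,A}f)(x)=\int_\Omega K(u)\,f(A(u)x)\,d\mu(u)$$ is a well-defined bounded operator on $L^2(\mathbb{R}^n)$ (the integral converging absolutely for almost every $x$), and its norm is equal to its spectral radius. Moreover, the family $A$ can be diagonalized simultaneously by an orthogonal matrix, and the following holds for every orthogonal matrix $C$ with $C^{-1}A(u)C=\mathrm{diag}(a_1(u),\dots,a_n(u))$ for all $u\in\Omega$ and every enumeration $U_1,\dots,U_{2^n}$ of the open hyperoctants of $\mathbb{R}^n$. For $1\le i,j\le 2^n$ let $\varepsilon(i,j)\in\{-1,1\}^n$ be the unique sign vector whose coordinatewise multiplication maps $U_i$ onto $U_j$, let $\Omega_{ij}=\{u\in\Omega:(\mathrm{sgn}\,a_1(u),\dots,\mathrm{sgn}\,a_n(u))=\varepsilon(i,j)\}$,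 and for $s\in\mathbb{R}^n$ let $\Phi(s)$ be the $2^n\times 2^n$ matrix with the entries $$\varphi_{ij}(s)=\int_{\Omega_{ij}}K(u)\prod_{k=1}^n|a_k(u)|^{-1/2-\mathrm{i}s_k}\,d\mu(u).$$ Then $$\|\mathcal{H}_{K,A}\|=\max\Bigl\{|\lambda|:\lambda\in\mathbb{C},\ \inf_{s\in\mathbb{R}^n}|\det(\lambda-\Phi(s))|=0\Bigr\}=\sup_{s\in\mathbb{R}^n}\|\Phi(s)\|,$$ where the maximum is attained and $\|\Phi(s)\|$ is the operator norm of $\Phi(s)$ on $\mathbb{C}^{2^n}$ with its Euclidean norm. -/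

import Mathlib

open MeasureTheory

noncomputable section

namespace Hausdorff

variable {n : ℕ} {Ω : Type*}

/-- The complex Hilbert space `L²(ℝⁿ)`. -/
abbrev L2 (n : ℕ) : Type :=
  Lp ℂ 2 (volume : Measure (EuclideanSpace ℝ (Fin n)))

/-- The product `M x` of a real matrix and a column vector `x ∈ ℝⁿ`. -/
def act (M : Matrix (Fin n) (Fin n) ℝ) (x : EuclideanSpace ℝ (Fin n)) :
    EuclideanSpace ℝ (Fin n) :=
  WithLp.toLp 2 (M.mulVec x.ofLp)

/-- `H` is the Hausdorff operator on `L²(ℝⁿ)` with kernel `K` and matrix family `A`: for every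
square-integrable function `f` (any representative of its class) and almost every `x`, the
integral `∫ K(u) f(A(u) x) dμ(u)` converges absolutely and equals `(H f)(x)`. -/
def IsHausdorffOperator [MeasurableSpace Ω] (μ : Measure Ω) (K : Ω → ℂ)
    (A : Ω → Matrix (Fin n) (Fin n) ℝ) (H : L2 n →L[ℂ] L2 n) : Prop :=
  ∀ (f : EuclideanSpace ℝ (Fin n) → ℂ) (hf : MemLp f 2 volume),
    ∀ᵐ x ∂(volume : Measure (EuclideanSpace ℝ (Fin n))),
      Integrable (fun u => K u * f (act (A u) x)) μ ∧
        (H (hf.toLp f)) x = ∫ u, K u * f (act (A u) x) ∂μ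

/-- There is at most one bounded operator given by the integral formula. -/
theorem IsHausdorffOperator.unique [MeasurableSpace Ω] {μ : Measure Ω} {K : Ω → ℂ}
    {A : Ω → Matrix (Fin n) (Fin n) ℝ} {H₁ H₂ : L2 n →L[ℂ] L2 n}
    (h₁ : IsHausdorffOperator μ K A H₁) (h₂ : IsHausdorffOperator μ K A H₂) : H₁ = H₂ := by
  ext1 f
  apply Lp.ext
  filter_upwards [h₁ f (Lp.memLp f), h₂ f (Lp.memLp f)] with x hx₁ hx₂
  rw [Lp.toLp_coeFn] at hx₁ hx₂
  rw [hx₁.2, hx₂.2]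

/-- The open hyperoctant of `ℝⁿ` with sign vector `σ ∈ {-1, 1}ⁿ`. The hyperoctants are in
bijection with the sign vectors, so an enumeration of the `2ⁿ` hyperoctants is a bijection
`e : Fin (2 ^ n) ≃ (Fin n → ℤˣ)`, the `j`-th hyperoctant being `octant (e j)`. -/
def octant (σ : Fin n → ℤˣ) : Set (Fin n → ℝ) :=
  {x | ∀ k, 0 < ((σ k : ℤ) : ℝ) * x k}

/-- The sign vector `ε(i, j)` which carries the `i`-th hyperoctant to the `j`-th one. -/
def eps (e : Fin (2 ^ n) ≃ (Fin n → ℤˣ)) (i j : Fin (2 ^ n)) : Fin n → ℤˣ :=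
  fun k => e i k * e j k

/-- `ε(i, j)` is the unique sign vector that maps the `i`-th hyperoctant onto the `j`-th one. -/
theorem image_octant_iff (e : Fin (2 ^ n) ≃ (Fin n → ℤˣ)) (i j : Fin (2 ^ n))
    (ε : Fin n → ℤˣ) :
    (fun x : Fin n → ℝ => fun k => ((ε k : ℤ) : ℝ) * x k) '' octant (e i) = octant (e j) ↔
      ε = eps e i j := by
  constructor
  · intro h
    have hx : (fun k => ((e i k : ℤ) : ℝ)) ∈ octant (e i) := by
      intro k
      rcases Int.units_eq_one_or (e i k) with h1 | h1 <;> simp [h1]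
    have hy : _ ∈ octant (e j) := h ▸ Set.mem_image_of_mem _ hx
    funext k
    have hk := hy k
    unfold eps
    rcases Int.units_eq_one_or (e i k) with h1 | h1 <;>
      rcases Int.units_eq_one_or (e j k) with h2 | h2 <;>
        rcases Int.units_eq_one_or (ε k) with h3 | h3 <;>
          simp only [h1, h2, h3] at hk ⊢ <;> first | rfl | (norm_num at hk)
  · rintro rfl
    have key : ∀ (p q : ℤˣ) (t : ℝ),
        (((p * q : ℤˣ) : ℤ) : ℝ) * ((((p * q : ℤˣ) : ℤ) : ℝ) * t) = t := by
      intro p q t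
      rcases Int.units_eq_one_or p with h1 | h1 <;>
        rcases Int.units_eq_one_or q with h2 | h2 <;> simp [h1, h2]
    have key2 : ∀ (p q : ℤˣ) (t : ℝ), ((q : ℤ) : ℝ) * ((((p * q : ℤˣ) : ℤ) : ℝ) * t)
        = ((p : ℤ) : ℝ) * t := by
      intro p q t
      rcases Int.units_eq_one_or p with h1 | h1 <;>
        rcases Int.units_eq_one_or q with h2 | h2 <;> simp [h1, h2]
    ext y
    constructor
    · rintro ⟨x, hx, rfl⟩ k
      have := hx k
      simp only [eps]
      rwa [key2]
    · intro hy
      refine ⟨fun k => ((eps e i j k : ℤ) : ℝ) * y k, fun k => ?_, ?_⟩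
      · have := hy k
        simp only [eps]
        rw [mul_comm (e i k), key2]
        exact this
      · funext k
        exact key _ _ _

/-- The orthogonal matrix `C` diagonalizes the family `A` simultaneously, and
`a(u) = (a₁(u), …, aₙ(u))` is the corresponding family of eigenvalues:
`C⁻¹ A(u) C = diag(a₁(u), …, aₙ(u))` for all `u` (here `C⁻¹ = Cᵀ`). -/
def Diagonalizes (A : Ω → Matrix (Fin n) (Fin n) ℝ) (C : Matrix (Fin n) (Fin n) ℝ)
    (a : Ω → Fin n → ℝ) : Prop :=
  C ∈ Matrix.orthogonalGroup (Fin n) ℝ ∧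
    ∀ u, C.transpose * A u * C = Matrix.diagonal (a u)

/-- The set `Ω_{ij}` of all `u` with `(sgn a₁(u), …, sgn aₙ(u)) = ε(i, j)`. -/
def signSet (e : Fin (2 ^ n) ≃ (Fin n → ℤˣ)) (a : Ω → Fin n → ℝ) (i j : Fin (2 ^ n)) : Set Ω :=
  {u | ∀ k, Real.sign (a u k) = ((eps e i j k : ℤ) : ℝ)}

/-- `|a|^{-1/2 - is} = ∏ₖ exp((-1/2 - i sₖ) log |aₖ|)`. -/
def absPow (a : Fin n → ℝ) (s : EuclideanSpace ℝ (Fin n)) : ℂ :=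
  ∏ k, Complex.exp ((-(1 / 2) - Complex.I * (s k : ℂ)) * (Real.log |a k| : ℂ))

/-- The matrix symbol `Φ(s) = (φ_{ij}(s))`, with
`φ_{ij}(s) = ∫_{Ω_{ij}} K(u) |a(u)|^{-1/2 - is} dμ(u)`. -/
def symbol [MeasurableSpace Ω] (μ : Measure Ω) (K : Ω → ℂ)
    (e : Fin (2 ^ n) ≃ (Fin n → ℤˣ)) (a : Ω → Fin n → ℝ) (s : EuclideanSpace ℝ (Fin n)) :
    Matrix (Fin (2 ^ n)) (Fin (2 ^ n)) ℂ :=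
  Matrix.of fun i j => ∫ u in signSet e a i j, K u * absPow (a u) s ∂μ

end Hausdorff

end

/-! Write `D(M) f = |det M|^{1/2} f(M ·)`; this is unitary on `L²(ℝⁿ)` when `M` is nonsingular. Then
`H` is the weak integral of `D(A(u))` against the integrable weight `|det A(u)|^{-1/2} K(u)`, so it
is bounded by the `L¹` norm of the weight. The `D(A(u))` commute with each other, hence unitarity
makes them commute with each other's adjoints as well. So `H` is normal, and its norm equals its
spectral radius (`IsAdmissible.isStarNormal`).

For the formula, rotate by `C` and use logarithmic coordinates in each hyperoctant, identifying
`L²(ℝⁿ)` with a sum of `2ⁿ` copies of `L²(ℝⁿ)`. There `diag(a)` permutes the hyperoctants by the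
signs of `a` and translates by `log |a|`. The Fourier transform turns translations into modulations,
so `H` becomes multiplication by the matrix function `ξ ↦ Φ(-2πξ)` (`inner_hausdorff_eq_integral`).
Since `Φ` is continuous, the norm of this multiplication operator is `sup ‖Φ(s)‖`
(`opNorm_le_of_norm_symbol_le`, `norm_symbol_le_opNorm`).

Finally, `φ_{ij}` depends only on the product of the sign vectors `i` and `j`, so `Φ(s)` is a
convolution matrix of the abelian group `{-1,1}ⁿ` and is normal (`isStarNormal_symbol`). The norm of
a normal matrix is the largest modulus of its eigenvalues. Compactness of the closure of `{Φ(s)}`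
turns the supremum into an attained maximum over approximate eigenvalues
(`isGreatest_of_isLUB_norm`). -/

noncomputable section

namespace Hausdorff

open scoped ENNReal

variable {n : ℕ}

/-! ### Weighted composition operators on L². -/

section WeightedComposition

variable {α : Type*} [MeasurableSpace α] {ν : Measure α} {ρ : α → ℝ} {φ : α → α}

/-- The weighted composition `f ↦ ρ · (f ∘ φ)` does not increase the integral of `|f|²`. -/
structure IsWeightedContraction (ν : Measure α) (ρ : α → ℝ) (φ : α → α) : Prop where
  measurable_weight : Measurable ρ
  measurable_map : Measurable φ
  lintegral_le : ∀ F : α → ℝ≥0∞, Measurable F → ∫⁻ x, ‖ρ x‖ₑ ^ 2 * F (φ x) ∂ν ≤ ∫⁻ x, F x ∂ν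

theorem eLpNorm_two_sq (f : α → ℂ) : eLpNorm f 2 ν ^ 2 = ∫⁻ x, ‖f x‖ₑ ^ 2 ∂ν := by
  rw [eLpNorm_eq_lintegral_rpow_enorm_toReal (by norm_num) (by norm_num)]
  rw [← ENNReal.rpow_natCast, ← ENNReal.rpow_mul]
  simp

/-- Testing the contraction inequality on the indicator of a null set shows that its preimage under
`φ` is null where `ρ ≠ 0`. This makes the weighted composition independent of the representative of
an `L²` class, although `φ` itself need not be nonsingular. -/
theorem IsWeightedContraction.ae_comp (h : IsWeightedContraction ν ρ φ) {p : α → Prop}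
    (hp : ∀ᵐ x ∂ν, p x) : ∀ᵐ x ∂ν, ρ x ≠ 0 → p (φ x) := by
  obtain ⟨N, hN, hNm, hN0⟩ := exists_measurable_superset_of_null (ae_iff.1 hp)
  have h0 := h.lintegral_le (N.indicator 1) (measurable_one.indicator hNm)
  rw [lintegral_indicator_one hNm, hN0, nonpos_iff_eq_zero, lintegral_eq_zero_iff] at h0
  · filter_upwards [h0] with x hx hρ
    by_contra hpx
    have : φ x ∈ N := hN hpx
    simp [this, hρ] at hx
  · exact (h.measurable_weight.enorm.pow_const 2).mul
      ((measurable_one.indicator hNm).comp h.measurable_map)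

theorem IsWeightedContraction.ae_eq_comp (h : IsWeightedContraction ν ρ φ) {f g : α → ℂ}
    (hfg : f =ᵐ[ν] g) : (fun x => (ρ x : ℂ) * f (φ x)) =ᵐ[ν] fun x => (ρ x : ℂ) * g (φ x) := by
  filter_upwards [h.ae_comp hfg] with x hx
  by_cases hρ : ρ x = 0
  · simp [hρ]
  · rw [hx hρ]

theorem IsWeightedContraction.aestronglyMeasurable (h : IsWeightedContraction ν ρ φ) {f : α → ℂ}
    (hf : AEStronglyMeasurable f ν) :
    AEStronglyMeasurable (fun x => (ρ x : ℂ) * f (φ x)) ν := by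
  refine AEStronglyMeasurable.congr ?_ (h.ae_eq_comp hf.ae_eq_mk).symm
  exact ((Complex.measurable_ofReal.comp h.measurable_weight).mul
    (hf.stronglyMeasurable_mk.measurable.comp h.measurable_map)).aestronglyMeasurable

theorem IsWeightedContraction.eLpNorm_sq (h : IsWeightedContraction ν ρ φ) {f : α → ℂ}
    (hf : AEStronglyMeasurable f ν) :
    eLpNorm (fun x => (ρ x : ℂ) * f (φ x)) 2 ν ^ 2
      = ∫⁻ x, ‖ρ x‖ₑ ^ 2 * ‖hf.mk f (φ x)‖ₑ ^ 2 ∂ν := by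
  rw [eLpNorm_congr_ae (h.ae_eq_comp hf.ae_eq_mk), eLpNorm_two_sq]
  refine lintegral_congr fun x => ?_
  rw [enorm_mul, mul_pow]
  congr 2
  simp [enorm_eq_nnnorm]

theorem IsWeightedContraction.eLpNorm_le (h : IsWeightedContraction ν ρ φ) {f : α → ℂ}
    (hf : AEStronglyMeasurable f ν) :
    eLpNorm (fun x => (ρ x : ℂ) * f (φ x)) 2 ν ≤ eLpNorm f 2 ν := by
  refine (ENNReal.pow_le_pow_left_iff two_ne_zero).1 ?_
  rw [h.eLpNorm_sq hf, eLpNorm_congr_ae hf.ae_eq_mk, eLpNorm_two_sq]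
  exact h.lintegral_le (fun y => ‖hf.mk f y‖ₑ ^ 2)
    (hf.stronglyMeasurable_mk.measurable.enorm.pow_const 2)

theorem IsWeightedContraction.memLp (h : IsWeightedContraction ν ρ φ) {f : α → ℂ}
    (hf : MemLp f 2 ν) : MemLp (fun x => (ρ x : ℂ) * f (φ x)) 2 ν :=
  ⟨h.aestronglyMeasurable hf.1, (h.eLpNorm_le hf.1).trans_lt hf.2⟩

/-- The weighted composition operator `f ↦ ρ · (f ∘ φ)` on `L²`. -/
def weightedComp (h : IsWeightedContraction ν ρ φ) : Lp ℂ 2 ν →L[ℂ] Lp ℂ 2 ν :=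
  LinearMap.mkContinuous
    { toFun := fun f => (h.memLp (Lp.memLp f)).toLp _
      map_add' := fun f g => by
        rw [← MemLp.toLp_add]
        refine MemLp.toLp_congr _ _ ((h.ae_eq_comp (Lp.coeFn_add f g)).trans (.of_forall fun x => ?_))
        simp [mul_add]
      map_smul' := fun c f => by
        rw [RingHom.id_apply, ← MemLp.toLp_const_smul]
        refine MemLp.toLp_congr _ _ ((h.ae_eq_comp (Lp.coeFn_smul c f)).trans (.of_forall fun x => ?_))
        simp [mul_left_comm] } 1 fun f => by
    rw [one_mul, LinearMap.coe_mk, AddHom.coe_mk, Lp.norm_toLp, Lp.norm_def]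
    exact ENNReal.toReal_mono (Lp.eLpNorm_ne_top f) (h.eLpNorm_le (Lp.memLp f).1)

theorem weightedComp_coeFn (h : IsWeightedContraction ν ρ φ) (f : Lp ℂ 2 ν) {g : α → ℂ}
    (hfg : f =ᵐ[ν] g) : weightedComp h f =ᵐ[ν] fun x => (ρ x : ℂ) * g (φ x) :=
  (MemLp.coeFn_toLp (h.memLp (Lp.memLp f))).trans (h.ae_eq_comp hfg)

theorem norm_weightedComp_le (h : IsWeightedContraction ν ρ φ) (f : Lp ℂ 2 ν) :
    ‖weightedComp h f‖ ≤ ‖f‖ := by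
  have := ContinuousLinearMap.le_of_opNorm_le (weightedComp h)
    (LinearMap.mkContinuous_norm_le _ zero_le_one _) f
  rwa [one_mul] at this

theorem norm_sq_eq_lintegral {f : Lp ℂ 2 ν} {g : α → ℂ} (hfg : f =ᵐ[ν] g) :
    ‖f‖ ^ 2 = (∫⁻ x, ‖g x‖ₑ ^ 2 ∂ν).toReal := by
  rw [← eLpNorm_two_sq, ENNReal.toReal_pow, Lp.norm_def, eLpNorm_congr_ae hfg]

theorem norm_sq_weightedComp (h : IsWeightedContraction ν ρ φ) {f : Lp ℂ 2 ν} {g : α → ℂ}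
    (hfg : f =ᵐ[ν] g) :
    ‖weightedComp h f‖ ^ 2 = (∫⁻ x, ‖ρ x‖ₑ ^ 2 * ‖g (φ x)‖ₑ ^ 2 ∂ν).toReal := by
  rw [norm_sq_eq_lintegral (weightedComp_coeFn h f hfg)]
  refine congrArg _ (lintegral_congr fun x => ?_)
  rw [enorm_mul, mul_pow]
  congr 2
  simp [enorm_eq_nnnorm]

theorem norm_weightedComp (h : IsWeightedContraction ν ρ φ)
    (heq : ∀ F : α → ℝ≥0∞, Measurable F → ∫⁻ x, ‖ρ x‖ₑ ^ 2 * F (φ x) ∂ν = ∫⁻ x, F x ∂ν)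
    (f : Lp ℂ 2 ν) : ‖weightedComp h f‖ = ‖f‖ := by
  refine (sq_eq_sq₀ (norm_nonneg _) (norm_nonneg _)).1 ?_
  rw [norm_sq_weightedComp h (Lp.memLp f).1.ae_eq_mk, norm_sq_eq_lintegral (Lp.memLp f).1.ae_eq_mk,
    heq (fun x => ‖(Lp.memLp f).1.mk f x‖ₑ ^ 2)
      ((Lp.memLp f).1.stronglyMeasurable_mk.measurable.enorm.pow_const 2)]

end WeightedComposition

/-! ### Normalized dilations. -/

section Dilation

theorem toEuclideanLin_eq_act (M : Matrix (Fin n) (Fin n) ℝ) :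
    ⇑(Matrix.toEuclideanLin M) = act M := rfl

theorem continuous_act (M : Matrix (Fin n) (Fin n) ℝ) : Continuous (act M) := by
  rw [← toEuclideanLin_eq_act]
  exact LinearMap.continuous_of_finiteDimensional _

theorem act_mul (M N : Matrix (Fin n) (Fin n) ℝ) (x : EuclideanSpace ℝ (Fin n)) :
    act (M * N) x = act M (act N x) := by
  simp [act, Matrix.mulVec_mulVec]

theorem act_one (x : EuclideanSpace ℝ (Fin n)) : act (1 : Matrix (Fin n) (Fin n) ℝ) x = x := by
  simp [act]

theorem lintegral_act (M : Matrix (Fin n) (Fin n) ℝ) (hM : M.det ≠ 0)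
    {F : EuclideanSpace ℝ (Fin n) → ℝ≥0∞} (hF : Measurable F) :
    ∫⁻ x, ‖Real.sqrt |M.det|‖ₑ ^ 2 * F (act M x) = ∫⁻ x, F x := by
  have hdet : LinearMap.det (Matrix.toEuclideanLin M) = M.det := by
    rw [Matrix.toEuclideanLin_eq_toLin_orthonormal, LinearMap.det_toLin]
  have hm := (continuous_act M).measurable
  have hmap := Measure.map_linearMap_addHaar_eq_smul_addHaar
    (volume : Measure (EuclideanSpace ℝ (Fin n))) (f := Matrix.toEuclideanLin M) (by rwa [hdet])
  rw [hdet, toEuclideanLin_eq_act] at hmap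
  rw [lintegral_const_mul _ (show Measurable fun x => F (act M x) from hF.comp hm),
    ← lintegral_map hF hm, hmap, lintegral_smul_measure,
    smul_eq_mul, ← mul_assoc, Real.enorm_eq_ofReal (Real.sqrt_nonneg _),
    ← ENNReal.ofReal_pow (Real.sqrt_nonneg _), Real.sq_sqrt (abs_nonneg _),
    ← ENNReal.ofReal_mul (abs_nonneg _), ← abs_mul, mul_inv_cancel₀ hM]
  simp

theorem isWeightedContraction_act (M : Matrix (Fin n) (Fin n) ℝ) :
    IsWeightedContraction (volume : Measure (EuclideanSpace ℝ (Fin n)))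
      (fun _ => Real.sqrt |M.det|) (act M) where
  measurable_weight := measurable_const
  measurable_map := (continuous_act M).measurable
  lintegral_le F hF := by
    -- For singular `M` the weight is zero, so `dilation M` is the zero operator and remains
    -- multiplicative in `M`.
    by_cases hM : M.det = 0
    · simp [hM]
    · exact (lintegral_act M hM hF).le

/-- The operator `f ↦ |det M|^{1/2} f(M ·)` on `L²(ℝⁿ)`. -/
def dilation (M : Matrix (Fin n) (Fin n) ℝ) : L2 n →L[ℂ] L2 n :=
  weightedComp (isWeightedContraction_act M)

theorem dilation_coeFn (M : Matrix (Fin n) (Fin n) ℝ) {f : L2 n}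
    {g : EuclideanSpace ℝ (Fin n) → ℂ} (hfg : f =ᵐ[volume] g) :
    dilation M f =ᵐ[volume] fun x => (Real.sqrt |M.det| : ℂ) * g (act M x) :=
  weightedComp_coeFn _ f hfg

theorem norm_dilation_le (M : Matrix (Fin n) (Fin n) ℝ) (f : L2 n) : ‖dilation M f‖ ≤ ‖f‖ :=
  norm_weightedComp_le _ f

theorem norm_dilation (M : Matrix (Fin n) (Fin n) ℝ) (hM : M.det ≠ 0) (f : L2 n) :
    ‖dilation M f‖ = ‖f‖ :=
  norm_weightedComp _ (fun _ hF => lintegral_act M hM hF) f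

theorem dilation_mul (M N : Matrix (Fin n) (Fin n) ℝ) :
    dilation (M * N) = dilation N * dilation M := by
  ext1 f
  apply Lp.ext
  have h := dilation_coeFn N (dilation_coeFn M (f := f) Filter.EventuallyEq.rfl)
  refine (dilation_coeFn (M * N) Filter.EventuallyEq.rfl).trans (Filter.EventuallyEq.trans ?_ h.symm)
  refine .of_forall fun x => ?_
  simp only [act_mul, Matrix.det_mul, abs_mul, Real.sqrt_mul (abs_nonneg _)]
  push_cast
  ring

theorem dilation_one : dilation (1 : Matrix (Fin n) (Fin n) ℝ) = 1 := by
  ext1 f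
  apply Lp.ext
  refine (dilation_coeFn _ Filter.EventuallyEq.rfl).trans (.of_forall fun x => ?_)
  simp [act_one]

end Dilation

/-! ### The Hausdorff operator as a weak integral of dilations. -/

section Integral

variable {Ω : Type*}

/-- The integrability weight `|det A(u)|^{-1/2} K(u)`. -/
def weight (K : Ω → ℂ) (A : Ω → Matrix (Fin n) (Fin n) ℝ) (u : Ω) : ℂ :=
  ((|(A u).det| ^ (-(1 / 2) : ℝ) : ℝ) : ℂ) * K u

variable {K : Ω → ℂ} {A : Ω → Matrix (Fin n) (Fin n) ℝ}

/-- The two powers of the determinant cancel where it is nonzero; elsewhere both sides vanish with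
`K`. Thus `K(u) f(A(u)x)` is the weight times the normalized dilation of `f`. -/
theorem weight_mul_sqrt {u : Ω} (h : K u ≠ 0 → (A u).det ≠ 0) :
    weight K A u * (Real.sqrt |(A u).det| : ℂ) = K u := by
  by_cases hK : K u = 0
  · simp [weight, hK]
  · have : 0 < |(A u).det| := abs_pos.2 (h hK)
    rw [weight, mul_right_comm, ← Complex.ofReal_mul, Real.sqrt_eq_rpow, ← Real.rpow_add this]
    norm_num

variable [MeasurableSpace Ω]

/-- The measurability and integrability conditions under which the Hausdorff operator is
bounded on `L²(ℝⁿ)`. -/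
structure IsAdmissible (μ : Measure Ω) (K : Ω → ℂ) (A : Ω → Matrix (Fin n) (Fin n) ℝ) : Prop where
  aemeasurable : ∀ k l, AEMeasurable (fun u => A u k l) μ
  nonsing : ∀ᵐ u ∂μ, K u ≠ 0 → (A u).det ≠ 0
  integrable_weight : Integrable (weight K A) μ

variable {μ : Measure Ω}

theorem aemeasurable_det (hA : ∀ k l, AEMeasurable (fun u => A u k l) μ) :
    AEMeasurable (fun u => (A u).det) μ := by
  simp only [Matrix.det_apply]
  refine Finset.aemeasurable_fun_sum _ fun σ _ => ?_
  exact (Finset.aemeasurable_fun_prod _ fun i _ => hA _ _).const_smul _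

theorem IsAdmissible.aestronglyMeasurable_kernel (h : IsAdmissible μ K A) :
    AEStronglyMeasurable K μ := by
  refine AEStronglyMeasurable.congr (h.integrable_weight.1.mul
    (Complex.measurable_ofReal.comp_aemeasurable
      (aemeasurable_det h.aemeasurable).abs.sqrt).aestronglyMeasurable) ?_
  filter_upwards [h.nonsing] with u hu using weight_mul_sqrt hu

/-- Composition with an a.e. measurable `f` is legitimate because, for a.e. `u` with `K(u) ≠ 0`, the
nonsingular map `A(u)` pulls null sets back to null sets. Fubini makes the exceptional set null in
the product. -/
theorem IsAdmissible.aestronglyMeasurable_comp (h : IsAdmissible μ K A)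
    {f : EuclideanSpace ℝ (Fin n) → ℂ} (hf : AEStronglyMeasurable f volume) :
    AEStronglyMeasurable (fun p : Ω × EuclideanSpace ℝ (Fin n) => K p.1 * f (act (A p.1) p.2))
      (μ.prod volume) := by
  have hK := h.aestronglyMeasurable_kernel
  let k' := hK.mk K
  let A' : Ω → Matrix (Fin n) (Fin n) ℝ := fun u => Matrix.of fun k l => (h.aemeasurable k l).mk _ u
  have hA' : ∀ᵐ u ∂μ, A u = A' u := by
    have : ∀ᵐ u ∂μ, ∀ k l, A u k l = (h.aemeasurable k l).mk _ u :=
      ae_all_iff.2 fun k => ae_all_iff.2 fun l => (h.aemeasurable k l).ae_eq_mk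
    filter_upwards [this] with u hu
    ext k l
    exact hu k l
  have hact : Measurable fun p : Ω × EuclideanSpace ℝ (Fin n) => act (A' p.1) p.2 := by
    refine (WithLp.measurable_toLp 2 (Fin n → ℝ)).comp (measurable_pi_iff.2 fun k => ?_)
    simp only [Matrix.mulVec, dotProduct]
    refine Finset.measurable_fun_sum _ fun l _ => Measurable.mul ?_ ?_
    · exact (h.aemeasurable k l).measurable_mk.comp measurable_fst
    · exact (EuclideanSpace.proj l : EuclideanSpace ℝ (Fin n) →L[ℝ] ℝ).continuous.measurable.comp
        measurable_snd
  have hk' : Measurable k' := hK.stronglyMeasurable_mk.measurable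
  -- A measurable null set is needed so that the good set in the product is measurable and can be
  -- tested slice by slice.
  obtain ⟨N, hN, hNm, hN0⟩ := exists_measurable_superset_of_null (ae_iff.1 hf.ae_eq_mk)
  have hgood : ∀ᵐ p ∂(μ.prod (volume : Measure (EuclideanSpace ℝ (Fin n)))),
      k' p.1 = 0 ∨ act (A' p.1) p.2 ∉ N := by
    rw [Measure.ae_prod_iff_ae_ae]
    · filter_upwards [h.nonsing, hK.ae_eq_mk, hA'] with u hu1 hu2 hu3
      by_cases hku : k' u = 0
      · simp [hku]
      · have hdet : (A u).det ≠ 0 := hu1 (by rw [hu2]; exact hku)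
        have hN' : ∀ᵐ x ∂(volume : Measure (EuclideanSpace ℝ (Fin n))), x ∉ N :=
          measure_eq_zero_iff_ae_notMem.1 hN0
        filter_upwards [(isWeightedContraction_act (A u)).ae_comp hN'] with x hx
        right
        rw [← hu3]
        refine hx ?_
        exact (Real.sqrt_pos.2 (abs_pos.2 hdet)).ne'
    · exact ((hk'.comp measurable_fst) (measurableSet_singleton 0)).union (hact hNm.compl)
  have hmeas : Measurable fun p : Ω × EuclideanSpace ℝ (Fin n) =>
      k' p.1 * hf.mk f (act (A' p.1) p.2) :=
    (hk'.comp measurable_fst).mul (hf.stronglyMeasurable_mk.measurable.comp hact)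
  refine hmeas.aestronglyMeasurable.congr ?_
  filter_upwards [hgood, Measure.quasiMeasurePreserving_fst.ae hK.ae_eq_mk,
    Measure.quasiMeasurePreserving_fst.ae hA'] with p hp1 hp2 hp3
  rw [hp2, hp3]
  rcases hp1 with hp1 | hp1
  · change k' p.1 * _ = k' p.1 * _
    rw [hp1]; simp
  · congr 1
    by_contra hne
    exact hp1 (hN fun h => hne h.symm)

theorem inner_dilation (M : Matrix (Fin n) (Fin n) ℝ) {f g : EuclideanSpace ℝ (Fin n) → ℂ}
    (hf : MemLp f 2 volume) (hg : MemLp g 2 volume) :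
    inner ℂ (hg.toLp g) (dilation M (hf.toLp f))
      = ∫ x, (Real.sqrt |M.det| : ℂ) * f (act M x) * starRingEnd ℂ (g x) := by
  rw [L2.inner_def]
  refine integral_congr_ae ?_
  filter_upwards [hg.coeFn_toLp, dilation_coeFn M hf.coeFn_toLp] with x hx1 hx2
  rw [hx1, hx2, RCLike.inner_apply]

/-- By Tonelli: for fixed `u`, Hölder and the contraction property bound the inner integral by
`|weight(u)| ‖f‖ ‖g‖`, which is integrable in `u`. -/
theorem IsAdmissible.integrable_prod [SFinite μ] (h : IsAdmissible μ K A)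
    {f g : EuclideanSpace ℝ (Fin n) → ℂ} (hf : MemLp f 2 volume) (hg : MemLp g 2 volume) :
    Integrable (fun p : Ω × EuclideanSpace ℝ (Fin n) =>
      K p.1 * f (act (A p.1) p.2) * starRingEnd ℂ (g p.2)) (μ.prod volume) := by
  have hgs : AEStronglyMeasurable (fun x => starRingEnd ℂ (g x)) volume :=
    Complex.continuous_conj.comp_aestronglyMeasurable hg.1
  have hm : AEStronglyMeasurable (fun p : Ω × EuclideanSpace ℝ (Fin n) =>
      K p.1 * f (act (A p.1) p.2) * starRingEnd ℂ (g p.2)) (μ.prod volume) :=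
    (h.aestronglyMeasurable_comp hf.1).mul hgs.comp_snd
  refine ⟨hm, ?_⟩
  rw [HasFiniteIntegral, lintegral_prod _ hm.enorm]
  have hbound : ∀ᵐ u ∂μ, ∫⁻ x, ‖K u * f (act (A u) x) * starRingEnd ℂ (g x)‖ₑ
      ≤ ‖weight K A u‖ₑ * (eLpNorm f 2 volume * eLpNorm g 2 volume) := by
    filter_upwards [h.nonsing] with u hu
    have hT := (isWeightedContraction_act (A u)).memLp hf
    have hle := (isWeightedContraction_act (A u)).eLpNorm_le hf.1
    have hcs := eLpNorm_smul_le_mul_eLpNorm (p := 2) (q := 2) (r := 1) hgs hT.1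
    rw [eLpNorm_one_eq_lintegral_enorm] at hcs
    have hgn : eLpNorm (fun x => starRingEnd ℂ (g x)) 2 volume = eLpNorm g 2 volume :=
      eLpNorm_congr_norm_ae (.of_forall fun x => RCLike.norm_conj (g x))
    rw [hgn] at hcs
    calc ∫⁻ x, ‖K u * f (act (A u) x) * starRingEnd ℂ (g x)‖ₑ
        = ∫⁻ x, ‖weight K A u‖ₑ * ‖((fun x => (Real.sqrt |(A u).det| : ℂ) * f (act (A u) x)) •
            fun x => starRingEnd ℂ (g x)) x‖ₑ := by
          refine lintegral_congr fun x => ?_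
          rw [← enorm_mul]
          congr 1
          rw [Pi.smul_apply', smul_eq_mul, ← weight_mul_sqrt hu]
          ring
      _ = ‖weight K A u‖ₑ * ∫⁻ x, ‖((fun x => (Real.sqrt |(A u).det| : ℂ) * f (act (A u) x)) •
            fun x => starRingEnd ℂ (g x)) x‖ₑ :=
          lintegral_const_mul'' _ (hT.1.smul hgs).enorm
      _ ≤ _ := by
          gcongr
          exact hcs.trans (by gcongr)
  refine (lintegral_mono_ae hbound).trans_lt ?_
  rw [lintegral_mul_const'' _ h.integrable_weight.1.enorm]
  exact ENNReal.mul_lt_top h.integrable_weight.2 (ENNReal.mul_lt_top hf.2 hg.2)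

theorem IsAdmissible.weight_mul_inner_eq (h : IsAdmissible μ K A)
    {f g : EuclideanSpace ℝ (Fin n) → ℂ} (hf : MemLp f 2 volume) (hg : MemLp g 2 volume) :
    ∀ᵐ u ∂μ, weight K A u * inner ℂ (hg.toLp g) (dilation (A u) (hf.toLp f))
      = ∫ x, K u * f (act (A u) x) * starRingEnd ℂ (g x) := by
  filter_upwards [h.nonsing] with u hu
  rw [inner_dilation, ← integral_const_mul]
  refine integral_congr_ae (.of_forall fun x => ?_)
  simp only
  rw [← weight_mul_sqrt hu]
  ring

theorem IsAdmissible.integrable_inner [SFinite μ] (h : IsAdmissible μ K A) (f g : L2 n) :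
    Integrable (fun u => weight K A u * inner ℂ g (dilation (A u) f)) μ := by
  have := h.weight_mul_inner_eq (Lp.memLp f) (Lp.memLp g)
  simp only [Lp.toLp_coeFn] at this
  exact (h.integrable_prod (Lp.memLp f) (Lp.memLp g)).integral_prod_left.congr
    (this.mono fun u hu => hu.symm)

theorem IsAdmissible.exists_operator [SFinite μ] (h : IsAdmissible μ K A) : ∃ H : L2 n →L[ℂ] L2 n,
    ∀ f g : L2 n, inner ℂ g (H f) = ∫ u, weight K A u * inner ℂ g (dilation (A u) f) ∂μ := by
  have hint := h.integrable_inner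
  -- The form is linear in `f` and conjugate-linear in `g`; conjugation gives the opposite
  -- convention required by the Riesz representation.
  let B : L2 n →ₗ⋆[ℂ] L2 n →ₗ[ℂ] ℂ := LinearMap.mk₂'ₛₗ (starRingEnd ℂ) (RingHom.id ℂ)
    (fun f g => starRingEnd ℂ (∫ u, weight K A u * inner ℂ g (dilation (A u) f) ∂μ))
    (fun f₁ f₂ g => by
      simp only [map_add, inner_add_right, mul_add]
      rw [integral_add (hint _ _) (hint _ _), map_add])
    (fun c f g => by
      simp only [map_smul, inner_smul_right, mul_left_comm _ c]
      rw [integral_const_mul, map_mul, smul_eq_mul])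
    (fun f g₁ g₂ => by
      simp only [inner_add_left, mul_add]
      rw [integral_add (hint _ _) (hint _ _), map_add])
    (fun c f g => by
      simp only [inner_smul_left, mul_left_comm _ (starRingEnd ℂ c)]
      rw [integral_const_mul, map_mul, Complex.conj_conj, smul_eq_mul, RingHom.id_apply])
  have hB : ∀ f g, ‖B f g‖ ≤ (∫ u, ‖weight K A u‖ ∂μ) * ‖f‖ * ‖g‖ := fun f g => by
    change ‖starRingEnd ℂ (∫ u, weight K A u * inner ℂ g (dilation (A u) f) ∂μ)‖ ≤ _
    rw [RCLike.norm_conj, mul_assoc, ← integral_mul_const]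
    refine norm_integral_le_of_norm_le (h.integrable_weight.norm.mul_const _) (.of_forall fun u => ?_)
    rw [norm_mul, mul_comm ‖f‖]
    gcongr
    exact (norm_inner_le_norm _ _).trans (by gcongr; exact norm_dilation_le _ _)
  refine ⟨InnerProductSpace.continuousLinearMapOfBilin (LinearMap.mkContinuous₂ B _ hB), fun f g => ?_⟩
  rw [← inner_conj_symm, InnerProductSpace.continuousLinearMapOfBilin_apply]
  exact Complex.conj_conj _

/-- Taking indicators of sets of finite measure as test functions, Fubini gives absolute convergence
a.e. and equality of all set integrals of `H f` and of the pointwise integral. -/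
theorem IsAdmissible.isHausdorffOperator [SFinite μ] (h : IsAdmissible μ K A) {H : L2 n →L[ℂ] L2 n}
    (hH : ∀ f g : L2 n, inner ℂ g (H f) = ∫ u, weight K A u * inner ℂ g (dilation (A u) f) ∂μ) :
    IsHausdorffOperator μ K A H := by
  intro f hf
  have hprod : ∀ s : Set (EuclideanSpace ℝ (Fin n)), MeasurableSet s → volume s < ∞ →
      Integrable (fun p : Ω × EuclideanSpace ℝ (Fin n) => K p.1 * f (act (A p.1) p.2))
        (μ.prod (volume.restrict s)) := fun s hs hs' => by
    have h1 := h.integrable_prod hf (memLp_indicator_const 2 hs (1 : ℂ) (.inr hs'.ne))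
    have h2 : μ.prod (volume.restrict s) = (μ.prod volume).restrict (Set.univ ×ˢ s) := by
      rw [← Measure.prod_restrict, Measure.restrict_univ]
    rw [h2]
    refine h1.integrableOn.congr_fun (s := Set.univ ×ˢ s) (fun p hp => ?_) (MeasurableSet.univ.prod hs)
    simp [Set.indicator_of_mem hp.2]
  have hint : ∀ᵐ x ∂(volume : Measure (EuclideanSpace ℝ (Fin n))),
      Integrable (fun u => K u * f (act (A u) x)) μ := by
    have : ∀ m, ∀ᵐ x ∂(volume : Measure (EuclideanSpace ℝ (Fin n))), x ∈ spanningSets volume m →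
        Integrable (fun u => K u * f (act (A u) x)) μ := fun m => by
      rw [← ae_restrict_iff' (measurableSet_spanningSets _ m)]
      exact (hprod _ (measurableSet_spanningSets _ m) (measure_spanningSets_lt_top _ m)).prod_left_ae
    filter_upwards [ae_all_iff.2 this] with x hx
    exact hx _ (mem_spanningSetsIndex volume x)
  have heq : H (hf.toLp f) =ᵐ[volume] fun x => ∫ u, K u * f (act (A u) x) ∂μ := by
    refine ae_eq_of_forall_setIntegral_eq_of_sigmaFinite (fun s hs hs' => ?_) (fun s hs hs' => ?_)
      fun s hs hs' => ?_
    · have : IsFiniteMeasure (volume.restrict s) := ⟨by simpa using hs'⟩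
      exact ((Lp.memLp _).restrict s).integrable (by norm_num)
    · exact (hprod s hs hs').integral_prod_right
    · rw [← L2.inner_indicatorConstLp_one (𝕜 := ℂ) hs hs'.ne, hH, ← integral_integral_swap
        (f := fun u x => K u * f (act (A u) x)) (hprod s hs hs')]
      refine integral_congr_ae ?_
      filter_upwards [h.weight_mul_inner_eq hf (memLp_indicator_const 2 hs (1 : ℂ) (.inr hs'.ne))]
        with u hu
      refine hu.trans ?_
      rw [← integral_indicator hs]
      refine integral_congr_ae (.of_forall fun x => ?_)
      by_cases hx : x ∈ s <;> simp [hx]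
  filter_upwards [hint, heq] with x h1 h2 using ⟨h1, h2⟩

end Integral

/-! ### Normality of the Hausdorff operator. -/

section Normal

variable {Ω : Type*} [MeasurableSpace Ω] {μ : Measure Ω} {K : Ω → ℂ}
  {A : Ω → Matrix (Fin n) (Fin n) ℝ} {H : L2 n →L[ℂ] L2 n}

theorem commute_of_weak_integral
    (hH : ∀ f g : L2 n, inner ℂ g (H f) = ∫ u, weight K A u * inner ℂ g (dilation (A u) f) ∂μ)
    {B : L2 n →L[ℂ] L2 n} (hB : ∀ᵐ u ∂μ, K u ≠ 0 → Commute B (dilation (A u))) :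
    Commute B H := by
  ext1 f
  refine ext_inner_left ℂ fun g => ?_
  change inner ℂ g (B (H f)) = inner ℂ g (H (B f))
  rw [← ContinuousLinearMap.adjoint_inner_left, hH, hH]
  refine integral_congr_ae ?_
  filter_upwards [hB] with u hu
  by_cases hK : K u = 0
  · simp [weight, hK]
  · have := congrArg (fun S : L2 n →L[ℂ] L2 n => S f) (hu hK).eq
    simp only [mul_apply_eq_comp] at this
    rw [ContinuousLinearMap.adjoint_inner_left, this]

theorem commute_dilation {M N : Matrix (Fin n) (Fin n) ℝ} (h : Commute M N) :
    Commute (dilation M) (dilation N) := by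
  rw [commute_iff_eq, ← dilation_mul, ← dilation_mul, h.eq]

theorem star_dilation_mul_self {M : Matrix (Fin n) (Fin n) ℝ} (hM : M.det ≠ 0) :
    star (dilation M) * dilation M = 1 :=
  (ContinuousLinearMap.norm_map_iff_adjoint_comp_self _).1 (norm_dilation M hM)

/-- The isometry `dilation M` has the right inverse `dilation M⁻¹`, which must therefore coincide
with its left inverse, the adjoint. -/
theorem dilation_mul_star_self {M : Matrix (Fin n) (Fin n) ℝ} (hM : M.det ≠ 0) :
    dilation M * star (dilation M) = 1 := by
  have h1 : dilation M * dilation M⁻¹ = 1 := by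
    rw [← dilation_mul, Matrix.nonsing_inv_mul _ (isUnit_iff_ne_zero.2 hM), dilation_one]
  rw [left_inv_eq_right_inv (star_dilation_mul_self hM) h1, h1]

theorem IsAdmissible.isStarNormal (h : IsAdmissible μ K A) (hA : ∀ u v, Commute (A u) (A v))
    (hH : ∀ f g : L2 n, inner ℂ g (H f) = ∫ u, weight K A u * inner ℂ g (dilation (A u) f) ∂μ) :
    IsStarNormal H := by
  have h1 : ∀ v, Commute (dilation (A v)) H := fun v =>
    commute_of_weak_integral hH (.of_forall fun u _ => commute_dilation (hA v u))
  -- The commutation lemma is used a second time, with `B = star H`: it is enough that `star H`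
  -- commutes with almost every dilation that carries weight. This is the adjoint of `h2`, which
  -- follows from `h1` by multiplying with the adjoint unitary on both sides.
  refine ⟨commute_of_weak_integral hH ?_⟩
  filter_upwards [h.nonsing] with v hv hK
  have h2 : Commute (star (dilation (A v))) H := by
    have hd := hv hK
    calc star (dilation (A v)) * H
        = star (dilation (A v)) * (H * dilation (A v)) * star (dilation (A v)) := by
          rw [mul_assoc, mul_assoc, dilation_mul_star_self hd, mul_one]
      _ = H * star (dilation (A v)) := by
          rw [← (h1 v).eq, ← mul_assoc, star_dilation_mul_self hd, one_mul]
  simpa using (commute_star_star.2 h2).symm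

end Normal

/-! ### Simultaneous orthogonal diagonalization. -/

/-- A commuting family of real symmetric matrices has an orthonormal basis of joint
eigenvectors. -/
theorem exists_orthonormal_joint_eigenvectors {Ω : Type*} {A : Ω → Matrix (Fin n) (Fin n) ℝ}
    (hcomm : ∀ u v, Commute (A u) (A v)) (hsymm : ∀ u, (A u).IsHermitian) :
    ∃ (b : Fin n → EuclideanSpace ℝ (Fin n)) (a : Ω → Fin n → ℝ), Orthonormal ℝ b ∧
      ∀ l u, act (A u) (b l) = a u l • b l := by
  classical
  let T : Ω → Module.End ℝ (EuclideanSpace ℝ (Fin n)) := fun u => Matrix.toEuclideanLin (A u)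
  have hT : ∀ u, (T u).IsSymmetric := fun u => Matrix.isSymmetric_toEuclideanLin_iff.2 (hsymm u)
  have hC : Pairwise (Function.onFun Commute T) := fun u v _ => by
    refine LinearMap.ext fun x => ?_
    change act (A u) (act (A v) x) = act (A v) (act (A u) x)
    rw [← act_mul, ← act_mul, (hcomm u v).eq]
  have hint := LinearMap.IsSymmetric.directSum_isInternal_of_pairwise_commute hT hC
  have horth := LinearMap.IsSymmetric.orthogonalFamily_iInf_eigenspaces hT
  let b₀ := hint.collectedBasis fun γ => (stdOrthonormalBasis ℝ
    (⨅ u, Module.End.eigenspace (T u) (γ u) : Submodule ℝ (EuclideanSpace ℝ (Fin n)))).toBasis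
  have hb₀ : Orthonormal ℝ b₀ := hint.collectedBasis_orthonormal horth fun γ => by
    simp
  -- The functions `γ : Ω → ℝ` may be infinitely many, but only finitely many joint eigenspaces are
  -- nonzero, since the collected vectors form a basis of `ℝⁿ`.
  have hfin : Finite (Σ γ : Ω → ℝ, Fin (Module.finrank ℝ
      (⨅ u, Module.End.eigenspace (T u) (γ u) : Submodule ℝ (EuclideanSpace ℝ (Fin n))))) :=
    Module.Finite.finite_basis b₀
  have : Fintype (Σ γ : Ω → ℝ, Fin (Module.finrank ℝ
      (⨅ u, Module.End.eigenspace (T u) (γ u) : Submodule ℝ (EuclideanSpace ℝ (Fin n))))) :=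
    Fintype.ofFinite _
  let ι := Fintype.equivFinOfCardEq (n := n) (by
    rw [← Module.finrank_eq_card_basis b₀, finrank_euclideanSpace_fin])
  let b := b₀.reindex ι
  have hb : Orthonormal ℝ b := by
    rw [Module.Basis.coe_reindex]
    exact hb₀.comp _ ι.symm.injective
  refine ⟨b, fun u l => (ι.symm l).1 u, hb, fun l u => ?_⟩
  have h1 := hint.collectedBasis_mem (fun γ => (stdOrthonormalBasis ℝ
    (⨅ u, Module.End.eigenspace (T u) (γ u) : Submodule ℝ
      (EuclideanSpace ℝ (Fin n)))).toBasis) (ι.symm l)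
  have h2 := Module.End.mem_eigenspace_iff.1 ((Submodule.mem_iInf _).1 h1 u)
  rw [show b l = b₀ (ι.symm l) from Module.Basis.reindex_apply _ _ _]
  exact h2

/-- A commuting family of real symmetric matrices is diagonalized by an orthogonal matrix. -/
theorem exists_diagonalizes {Ω : Type*} {A : Ω → Matrix (Fin n) (Fin n) ℝ}
    (hcomm : ∀ u v, Commute (A u) (A v)) (hsymm : ∀ u, (A u).IsHermitian) :
    ∃ C a, Diagonalizes A C a := by
  obtain ⟨b, a, hb, hmem⟩ := exists_orthonormal_joint_eigenvectors hcomm hsymm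
  let C : Matrix (Fin n) (Fin n) ℝ := Matrix.of fun k l => b l k
  have hCC : C.transpose * C = 1 := by
    ext k l
    have h1 := (orthonormal_iff_ite.1 hb) k l
    rw [PiLp.inner_apply] at h1
    rw [Matrix.mul_apply, Matrix.one_apply, ← h1]
    refine Finset.sum_congr rfl fun j _ => ?_
    simp [C, mul_comm]
  refine ⟨C, a, ?_, fun u => ?_⟩
  · exact (Matrix.mem_orthogonalGroup_iff' (Fin n) ℝ).2 hCC
  · have : A u * C = C * Matrix.diagonal (a u) := by
      ext k l
      have h1 := congrArg (fun x : EuclideanSpace ℝ (Fin n) => x k) (hmem l u)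
      simp only [act, Matrix.mulVec, dotProduct, PiLp.smul_apply, smul_eq_mul] at h1
      rw [Matrix.mul_diagonal, mul_comm, Matrix.mul_apply]
      exact h1
    rw [Matrix.mul_assoc, this, ← Matrix.mul_assoc, hCC, Matrix.one_mul]

/-! ### Logarithmic coordinates on the hyperoctants. -/

section ExpChart

theorem intUnit_mul_self (s : ℤˣ) : ((s : ℤ) : ℝ) * ((s : ℤ) : ℝ) = 1 := by
  rcases Int.units_eq_one_or s with h | h <;> simp [h]

theorem abs_intUnit (s : ℤˣ) : |((s : ℤ) : ℝ)| = 1 := by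
  rcases Int.units_eq_one_or s with h | h <;> simp [h]

/-- The exponential parametrization of the hyperoctant with sign vector `σ`. -/
def expChart (σ : Fin n → ℤˣ) (t : EuclideanSpace ℝ (Fin n)) : EuclideanSpace ℝ (Fin n) :=
  WithLp.toLp 2 fun k => ((σ k : ℤ) : ℝ) * Real.exp (t k)

/-- The logarithm of the absolute values of the coordinates. -/
def logAbs (x : EuclideanSpace ℝ (Fin n)) : EuclideanSpace ℝ (Fin n) :=
  WithLp.toLp 2 fun k => Real.log |x k|

theorem logAbs_expChart (σ : Fin n → ℤˣ) (t : EuclideanSpace ℝ (Fin n)) :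
    logAbs (expChart σ t) = t := by
  ext k
  simp [logAbs, expChart, abs_mul, abs_intUnit]

theorem expChart_mem_octant (σ τ : Fin n → ℤˣ) (t : EuclideanSpace ℝ (Fin n)) :
    (expChart σ t).ofLp ∈ octant τ ↔ σ = τ := by
  constructor
  · intro h
    funext k
    have hk := h k
    simp only [expChart] at hk
    rw [← mul_assoc, mul_pos_iff_of_pos_right (Real.exp_pos _)] at hk
    rcases Int.units_eq_one_or (σ k) with h1 | h1 <;>
      rcases Int.units_eq_one_or (τ k) with h2 | h2 <;>
        simp only [h1, h2] at hk ⊢ <;> norm_num at hk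
  · rintro rfl k
    simp only [expChart]
    rw [← mul_assoc, intUnit_mul_self, one_mul]
    exact Real.exp_pos _

theorem expChart_logAbs {σ : Fin n → ℤˣ} {x : EuclideanSpace ℝ (Fin n)}
    (hx : x.ofLp ∈ octant σ) : expChart σ (logAbs x) = x := by
  ext k
  have hk := hx k
  have hne : x k ≠ 0 := by
    intro h0
    rw [h0, mul_zero] at hk
    exact lt_irrefl _ hk
  simp only [expChart, logAbs, Real.exp_log (abs_pos.2 hne)]
  rcases Int.units_eq_one_or (σ k) with h1 | h1 <;> simp only [h1] at hk ⊢ <;> norm_num at hk ⊢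
  · exact hk.le
  · rw [abs_of_neg hk, neg_neg]

theorem image_expChart (σ : Fin n → ℤˣ) :
    expChart σ '' Set.univ = {x : EuclideanSpace ℝ (Fin n) | x.ofLp ∈ octant σ} := by
  ext x
  constructor
  · rintro ⟨t, -, rfl⟩
    exact (expChart_mem_octant σ σ t).2 rfl
  · exact fun hx => ⟨logAbs x, trivial, expChart_logAbs hx⟩

theorem injective_expChart (σ : Fin n → ℤˣ) : Function.Injective (expChart σ) :=
  Function.LeftInverse.injective (g := logAbs) (logAbs_expChart σ)

theorem hasFDerivAt_expChart (σ : Fin n → ℤˣ) (t : EuclideanSpace ℝ (Fin n)) :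
    HasFDerivAt (expChart σ) (LinearMap.toContinuousLinearMap (Matrix.toEuclideanLin
      (Matrix.diagonal fun k => ((σ k : ℤ) : ℝ) * Real.exp (t k)))) t := by
  rw [← hasFDerivWithinAt_univ, hasFDerivWithinAt_euclidean]
  intro k
  have h1 : HasFDerivAt (fun t : EuclideanSpace ℝ (Fin n) => ((σ k : ℤ) : ℝ) * Real.exp (t k))
      (((σ k : ℤ) : ℝ) • (Real.exp (t k) •
        (EuclideanSpace.proj k : EuclideanSpace ℝ (Fin n) →L[ℝ] ℝ))) t :=
    ((EuclideanSpace.proj k : EuclideanSpace ℝ (Fin n) →L[ℝ] ℝ).hasFDerivAt.exp).const_mul _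
  rw [hasFDerivWithinAt_univ]
  refine h1.congr_fderiv ?_
  ext v
  simp [Matrix.toEuclideanLin, Matrix.mulVec_diagonal, mul_assoc]

/-- The density `exp(∑ tₖ / 2)` of the exponential charts. -/
def chartWeight (t : EuclideanSpace ℝ (Fin n)) : ℝ := Real.exp ((∑ k, t k) / 2)

theorem continuous_chartWeight : Continuous (chartWeight (n := n)) := by
  unfold chartWeight
  fun_prop

theorem chartWeight_sq (t : EuclideanSpace ℝ (Fin n)) :
    chartWeight t ^ 2 = Real.exp (∑ k, t k) := by
  rw [chartWeight, ← Real.exp_nat_mul]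
  congr 1
  push_cast
  ring

theorem enorm_chartWeight_sq (t : EuclideanSpace ℝ (Fin n)) :
    ‖chartWeight t‖ₑ ^ 2 = ENNReal.ofReal (Real.exp (∑ k, t k)) := by
  have h : 0 ≤ chartWeight t := (Real.exp_pos _).le
  rw [Real.enorm_eq_ofReal h, ← ENNReal.ofReal_pow h, chartWeight_sq]

/-- Change of variables: the Jacobian determinant of the chart has modulus `exp(∑ tₖ)`, the square
of `chartWeight`. -/
theorem lintegral_expChart (σ : Fin n → ℤˣ) (F : EuclideanSpace ℝ (Fin n) → ℝ≥0∞) :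
    ∫⁻ t, ‖chartWeight t‖ₑ ^ 2 * F (expChart σ t) = ∫⁻ x in {x | x.ofLp ∈ octant σ}, F x := by
  rw [← image_expChart, lintegral_image_eq_lintegral_abs_det_fderiv_mul volume MeasurableSet.univ
    (fun t _ => (hasFDerivAt_expChart σ t).hasFDerivWithinAt) (injective_expChart σ).injOn,
    Measure.restrict_univ]
  refine lintegral_congr fun t => ?_
  rw [enorm_chartWeight_sq]
  congr 2
  rw [ContinuousLinearMap.det, LinearMap.coe_toContinuousLinearMap,
    Matrix.toEuclideanLin_eq_toLin_orthonormal, LinearMap.det_toLin, Matrix.det_diagonal,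
    Finset.abs_prod, Real.exp_sum]
  refine Finset.prod_congr rfl fun k _ => ?_
  rw [abs_mul, abs_intUnit, one_mul, abs_of_pos (Real.exp_pos _)]

theorem measurableSet_octant (σ : Fin n → ℤˣ) :
    MeasurableSet {x : EuclideanSpace ℝ (Fin n) | x.ofLp ∈ octant σ} := by
  have : {x : EuclideanSpace ℝ (Fin n) | x.ofLp ∈ octant σ}
      = ⋂ k, {x : EuclideanSpace ℝ (Fin n) | 0 < ((σ k : ℤ) : ℝ) * x k} := by
    ext x; simp [octant]
  rw [this]
  refine MeasurableSet.iInter fun k => measurableSet_lt measurable_const ?_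
  exact (by fun_prop : Continuous fun x : EuclideanSpace ℝ (Fin n) =>
    ((σ k : ℤ) : ℝ) * x k).measurable

theorem ae_ne_zero : ∀ᵐ x ∂(volume : Measure (EuclideanSpace ℝ (Fin n))), ∀ k, x k ≠ 0 := by
  have h : ∀ᵐ x ∂(volume : Measure (Fin n → ℝ)), ∀ k, x k ≠ 0 :=
    ae_all_iff.2 fun k => measure_eq_zero_iff_ae_notMem.1 (Measure.pi_hyperplane _ k 0)
  exact (PiLp.volume_preserving_ofLp (Fin n)).quasiMeasurePreserving.ae h

theorem exists_mem_octant {x : Fin n → ℝ} (hx : ∀ k, x k ≠ 0) : ∃ σ, x ∈ octant σ := by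
  refine ⟨fun k => if 0 < x k then 1 else -1, fun k => ?_⟩
  by_cases h : 0 < x k
  · simp [h]
  · simpa [h] using lt_of_le_of_ne (not_lt.1 h) (hx k)

theorem octant_disjoint {σ τ : Fin n → ℤˣ} {x : EuclideanSpace ℝ (Fin n)}
    (hσ : x.ofLp ∈ octant σ) (hτ : x.ofLp ∈ octant τ) : σ = τ := by
  rw [← expChart_logAbs hσ] at hτ
  exact (expChart_mem_octant σ τ _).1 hτ

/-- The hyperoctants partition `ℝⁿ` up to the coordinate hyperplanes, which are null. -/
theorem sum_lintegral_expChart (F : EuclideanSpace ℝ (Fin n) → ℝ≥0∞) :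
    ∑ σ : Fin n → ℤˣ, ∫⁻ t, ‖chartWeight t‖ₑ ^ 2 * F (expChart σ t) = ∫⁻ x, F x := by
  simp only [lintegral_expChart]
  rw [← tsum_fintype (L := SummationFilter.unconditional _),
    ← lintegral_iUnion measurableSet_octant fun σ τ hne =>
    Set.disjoint_left.2 fun x hσ hτ => hne (octant_disjoint hσ hτ), setLIntegral_congr
    (t := Set.univ), setLIntegral_univ]
  refine Filter.eventuallyEq_set.2 ?_
  filter_upwards [ae_ne_zero] with x hx
  simpa using exists_mem_octant hx

end ExpChart

/-! ### Decomposition of L² over the rotated hyperoctants. -/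

section RotatedChart

variable {C : Matrix (Fin n) (Fin n) ℝ}

theorem lintegral_act_orthogonal (hC : C ∈ Matrix.orthogonalGroup (Fin n) ℝ)
    {F : EuclideanSpace ℝ (Fin n) → ℝ≥0∞} (hF : Measurable F) :
    ∫⁻ x, F (act C x) = ∫⁻ x, F x := by
  have h1 : C.det * C.det = 1 := by
    have h := congrArg Matrix.det ((Matrix.mem_orthogonalGroup_iff' (Fin n) ℝ).1 hC)
    rwa [Matrix.det_mul, Matrix.det_transpose, Matrix.det_one] at h
  have h2 : |C.det| = 1 := by
    rw [← sq_eq_sq₀ (abs_nonneg _) zero_le_one, sq_abs, sq, h1, one_pow]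
  have h3 : C.det ≠ 0 := fun h => by simp [h] at h1
  rw [← lintegral_act C h3 hF]
  simp [h2]

/-- The exponential parametrization of the image of a hyperoctant under `C`. -/
def chart (C : Matrix (Fin n) (Fin n) ℝ) (σ : Fin n → ℤˣ) (t : EuclideanSpace ℝ (Fin n)) :
    EuclideanSpace ℝ (Fin n) :=
  act C (expChart σ t)

theorem continuous_expChart (σ : Fin n → ℤˣ) : Continuous (expChart σ) :=
  continuous_iff_continuousAt.2 fun t => (hasFDerivAt_expChart σ t).continuousAt

theorem continuous_chart (σ : Fin n → ℤˣ) : Continuous (chart C σ) :=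
  (continuous_act C).comp (continuous_expChart σ)

theorem sum_lintegral_chart (hC : C ∈ Matrix.orthogonalGroup (Fin n) ℝ)
    {F : EuclideanSpace ℝ (Fin n) → ℝ≥0∞} (hF : Measurable F) :
    ∑ σ : Fin n → ℤˣ, ∫⁻ t, ‖chartWeight t‖ₑ ^ 2 * F (chart C σ t) = ∫⁻ x, F x := by
  rw [← lintegral_act_orthogonal hC hF]
  exact sum_lintegral_expChart fun x => F (act C x)

theorem isWeightedContraction_chart (hC : C ∈ Matrix.orthogonalGroup (Fin n) ℝ)
    (σ : Fin n → ℤˣ) : IsWeightedContraction (volume : Measure (EuclideanSpace ℝ (Fin n)))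
      chartWeight (chart C σ) where
  measurable_weight := continuous_chartWeight.measurable
  measurable_map := (continuous_chart σ).measurable
  lintegral_le F hF := by
    rw [← sum_lintegral_chart hC hF]
    exact Finset.single_le_sum
      (f := fun σ => ∫⁻ t, ‖chartWeight t‖ₑ ^ 2 * F (chart C σ t)) (fun _ _ => zero_le)
      (Finset.mem_univ σ)

/-- The part of a function on the `σ`-th hyperoctant (rotated by `C`) in logarithmic
coordinates. -/
def logPart (hC : C ∈ Matrix.orthogonalGroup (Fin n) ℝ) (σ : Fin n → ℤˣ) : L2 n →L[ℂ] L2 n :=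
  weightedComp (isWeightedContraction_chart hC σ)

theorem logPart_coeFn (hC : C ∈ Matrix.orthogonalGroup (Fin n) ℝ) (σ : Fin n → ℤˣ) {f : L2 n}
    {g : EuclideanSpace ℝ (Fin n) → ℂ} (hfg : f =ᵐ[volume] g) :
    logPart hC σ f =ᵐ[volume] fun t => (chartWeight t : ℂ) * g (chart C σ t) :=
  weightedComp_coeFn _ f hfg

theorem sum_norm_sq_logPart (hC : C ∈ Matrix.orthogonalGroup (Fin n) ℝ) (f : L2 n) :
    ∑ σ, ‖logPart hC σ f‖ ^ 2 = ‖f‖ ^ 2 := by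
  have hm := (Lp.memLp f).1.stronglyMeasurable_mk.measurable.enorm.pow_const 2
  rw [norm_sq_eq_lintegral (Lp.memLp f).1.ae_eq_mk, ← sum_lintegral_chart hC hm,
    ENNReal.toReal_sum]
  · exact Finset.sum_congr rfl fun σ _ => norm_sq_weightedComp _ (Lp.memLp f).1.ae_eq_mk
  · refine fun σ _ => ne_top_of_le_ne_top ?_ ((isWeightedContraction_chart hC σ).lintegral_le _ hm)
    rw [← eLpNorm_two_sq, ← eLpNorm_congr_ae (Lp.memLp f).1.ae_eq_mk]
    exact ENNReal.pow_ne_top (Lp.eLpNorm_ne_top f)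

/-- The weight of the inverse of the chart with sign vector `σ`. -/
def unchartWeight (C : Matrix (Fin n) (Fin n) ℝ) (σ : Fin n → ℤˣ)
    (x : EuclideanSpace ℝ (Fin n)) : ℝ :=
  Set.indicator {x : EuclideanSpace ℝ (Fin n) | x.ofLp ∈ octant σ}
    (fun y => (chartWeight (logAbs y))⁻¹) (act C.transpose x)

theorem act_transpose_chart (hC : C ∈ Matrix.orthogonalGroup (Fin n) ℝ) (σ : Fin n → ℤˣ)
    (t : EuclideanSpace ℝ (Fin n)) : act C.transpose (chart C σ t) = expChart σ t := by
  rw [chart, ← act_mul, show C.transpose * C = 1 from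
    (Matrix.mem_orthogonalGroup_iff' (Fin n) ℝ).1 hC, act_one]

theorem unchartWeight_chart (hC : C ∈ Matrix.orthogonalGroup (Fin n) ℝ) (σ τ : Fin n → ℤˣ)
    (t : EuclideanSpace ℝ (Fin n)) :
    unchartWeight C σ (chart C τ t) = if τ = σ then (chartWeight t)⁻¹ else 0 := by
  rw [unchartWeight, act_transpose_chart hC]
  have hmem : expChart τ t ∈ {x : EuclideanSpace ℝ (Fin n) | x.ofLp ∈ octant σ} ↔ τ = σ :=
    expChart_mem_octant τ σ t
  split_ifs with h
  · rw [Set.indicator_of_mem (hmem.2 h), logAbs_expChart]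
  · exact Set.indicator_of_notMem (mt hmem.1 h) _

theorem measurable_logAbs : Measurable (logAbs (n := n)) := by
  refine (WithLp.measurable_toLp 2 (Fin n → ℝ)).comp (measurable_pi_iff.2 fun k => ?_)
  exact Real.measurable_log.comp (by fun_prop : Continuous fun x : EuclideanSpace ℝ (Fin n) =>
    |x k|).measurable

/-- Evaluated in the charts, only the hyperoctant `σ` contributes, and there the two weights cancel.
-/
theorem isWeightedContraction_unchart (hC : C ∈ Matrix.orthogonalGroup (Fin n) ℝ)
    (σ : Fin n → ℤˣ) : IsWeightedContraction (volume : Measure (EuclideanSpace ℝ (Fin n)))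
      (unchartWeight C σ) (fun x => logAbs (act C.transpose x)) := by
  have h1 : Measurable (unchartWeight C σ) :=
    ((continuous_chartWeight.measurable.comp measurable_logAbs).inv.indicator
      (measurableSet_octant σ)).comp (continuous_act _).measurable
  have h2 : Measurable fun x => logAbs (act C.transpose x) :=
    measurable_logAbs.comp (continuous_act _).measurable
  refine ⟨h1, h2, fun F hF => ?_⟩
  have h3 : Measurable fun x => ‖unchartWeight C σ x‖ₑ ^ 2 * F (logAbs (act C.transpose x)) :=
    (h1.enorm.pow_const 2).mul (hF.comp h2)
  rw [← sum_lintegral_chart hC h3, Finset.sum_eq_single σ]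
  · refine (lintegral_congr fun t => ?_).le
    have : chartWeight t ≠ 0 := (Real.exp_pos _).ne'
    rw [unchartWeight_chart hC, if_pos rfl, act_transpose_chart hC, logAbs_expChart, ← mul_assoc,
      ← mul_pow, ← enorm_mul, mul_inv_cancel₀ this]
    simp
  · intro τ _ hτ
    simp [unchartWeight_chart hC, hτ]
  · simp

/-- The function with a given logarithmic part in one hyperoctant, and zero elsewhere. -/
def ofLogPart (hC : C ∈ Matrix.orthogonalGroup (Fin n) ℝ) (σ : Fin n → ℤˣ) : L2 n →L[ℂ] L2 n :=
  weightedComp (isWeightedContraction_unchart hC σ)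

theorem logPart_ofLogPart (hC : C ∈ Matrix.orthogonalGroup (Fin n) ℝ) (σ τ : Fin n → ℤˣ)
    (h : L2 n) : logPart hC τ (ofLogPart hC σ h) = if τ = σ then h else 0 := by
  apply Lp.ext
  refine (logPart_coeFn hC τ (weightedComp_coeFn (isWeightedContraction_unchart hC σ) h
    Filter.EventuallyEq.rfl)).trans ?_
  by_cases hτ : τ = σ
  · rw [if_pos hτ]
    refine .of_forall fun t => ?_
    have : (chartWeight t : ℂ) ≠ 0 := Complex.ofReal_ne_zero.2 (Real.exp_pos _).ne'
    simp only [unchartWeight_chart hC, if_pos hτ, act_transpose_chart hC, logAbs_expChart]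
    rw [Complex.ofReal_inv, mul_inv_cancel_left₀ this]
  · rw [if_neg hτ]
    refine Filter.EventuallyEq.trans (.of_forall fun t => ?_) (Lp.coeFn_zero ℂ 2 volume).symm
    simp [unchartWeight_chart hC, hτ]

end RotatedChart

/-! ### Dilations as translations in logarithmic coordinates. -/

section Translation

theorem isWeightedContraction_translate (b : EuclideanSpace ℝ (Fin n)) :
    IsWeightedContraction (volume : Measure (EuclideanSpace ℝ (Fin n)))
      (fun _ => 1) (fun t => t + b) where
  measurable_weight := measurable_const
  measurable_map := measurable_id.add_const b
  lintegral_le F _ := by simp [lintegral_add_right_eq_self F b]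

/-- The translation `f ↦ f(· + b)` on `L²(ℝⁿ)`. -/
def translate (b : EuclideanSpace ℝ (Fin n)) : L2 n →L[ℂ] L2 n :=
  weightedComp (isWeightedContraction_translate b)

theorem translate_coeFn (b : EuclideanSpace ℝ (Fin n)) {f : L2 n}
    {g : EuclideanSpace ℝ (Fin n) → ℂ} (hfg : f =ᵐ[volume] g) :
    translate b f =ᵐ[volume] fun t => g (t + b) := by
  refine (weightedComp_coeFn (isWeightedContraction_translate b) f hfg).trans (.of_forall fun t => ?_)
  simp

variable {C M : Matrix (Fin n) (Fin n) ℝ}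

theorem sign_mul_abs_self (x : ℝ) : Real.sign x * |x| = x := by
  rcases lt_trichotomy x 0 with h | h | h
  · rw [Real.sign_of_neg h, abs_of_neg h]; ring
  · simp [h]
  · rw [Real.sign_of_pos h, abs_of_pos h, one_mul]

theorem act_chart (hC : C ∈ Matrix.orthogonalGroup (Fin n) ℝ) {a : Fin n → ℝ}
    (hM : C.transpose * M * C = Matrix.diagonal a) {σ τ : Fin n → ℤˣ}
    (ha : ∀ k, Real.sign (a k) = (((σ k * τ k : ℤˣ) : ℤ) : ℝ)) (t : EuclideanSpace ℝ (Fin n)) :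
    act M (chart C σ t) = chart C τ (t + logAbs (WithLp.toLp 2 a)) := by
  have hCM : M * C = C * Matrix.diagonal a := by
    rw [← hM, ← Matrix.mul_assoc, ← Matrix.mul_assoc, show C * C.transpose = 1 from
      (Matrix.mem_orthogonalGroup_iff (Fin n) ℝ).1 hC, Matrix.one_mul]
  rw [chart, ← act_mul, hCM, act_mul, chart]
  congr 1
  ext k
  have hk : a k ≠ 0 := fun h0 => by
    have := ha k
    rw [h0, Real.sign_zero] at this
    have h1 := abs_intUnit (σ k * τ k)
    rw [← this] at h1
    norm_num at h1
  simp only [act, expChart, logAbs, Matrix.mulVec_diagonal, PiLp.add_apply, Real.exp_add,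
    Real.exp_log (abs_pos.2 hk)]
  conv_lhs => rw [← sign_mul_abs_self (a k), ha k]
  push_cast
  linear_combination (((τ k : ℤ) : ℝ) * |a k| * Real.exp (t k)) * intUnit_mul_self (σ k)

/-- The normalizing factor of the dilation is exactly what turns `chartWeight t` into `chartWeight
(t + log |a|)`, so that `logPart_dilation` yields a translation without a weight. -/
theorem sqrt_abs_det (hC : C ∈ Matrix.orthogonalGroup (Fin n) ℝ) {a : Fin n → ℝ}
    (hM : C.transpose * M * C = Matrix.diagonal a) (ha : ∀ k, a k ≠ 0) :
    Real.sqrt |M.det| = chartWeight (logAbs (WithLp.toLp 2 a)) := by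
  have hdet : M.det = ∏ k, a k := by
    rw [← Matrix.det_diagonal, ← hM, Matrix.det_mul_right_comm, Matrix.det_mul,
      show C.transpose * C = 1 from (Matrix.mem_orthogonalGroup_iff' (Fin n) ℝ).1 hC,
      Matrix.det_one, one_mul]
  have h : 0 ≤ chartWeight (logAbs (WithLp.toLp 2 a)) := (Real.exp_pos _).le
  rw [Real.sqrt_eq_iff_eq_sq (abs_nonneg _) h, chartWeight_sq, hdet,
    Finset.abs_prod, Real.exp_sum]
  exact Finset.prod_congr rfl fun k _ => (Real.exp_log (abs_pos.2 (ha k))).symm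

theorem logPart_dilation (hC : C ∈ Matrix.orthogonalGroup (Fin n) ℝ) {a : Fin n → ℝ}
    (hM : C.transpose * M * C = Matrix.diagonal a) {σ τ : Fin n → ℤˣ}
    (ha : ∀ k, Real.sign (a k) = (((σ k * τ k : ℤˣ) : ℤ) : ℝ)) (f : L2 n) :
    logPart hC σ (dilation M f) = translate (logAbs (WithLp.toLp 2 a)) (logPart hC τ f) := by
  have hne : ∀ k, a k ≠ 0 := fun k h0 => by
    have h1 := abs_intUnit (σ k * τ k)
    rw [← ha k, h0, Real.sign_zero] at h1
    norm_num at h1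
  apply Lp.ext
  refine (logPart_coeFn hC σ (dilation_coeFn M (f := f) Filter.EventuallyEq.rfl)).trans
    (Filter.EventuallyEq.trans (.of_forall fun t => ?_)
    (translate_coeFn _ (logPart_coeFn hC τ (f := f) Filter.EventuallyEq.rfl)).symm)
  simp only
  rw [act_chart hC hM ha, sqrt_abs_det hC hM hne, ← mul_assoc, ← Complex.ofReal_mul]
  congr 2
  rw [chartWeight, chartWeight, chartWeight, ← Real.exp_add]
  congr 1
  simp only [PiLp.add_apply, Finset.sum_add_distrib]
  ring

end Translation

/-! ### The Fourier transform of a translation. -/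

section Fourier

open scoped FourierTransform SchwartzMap

/-- The character `ξ ↦ exp(2πi⟨b, ξ⟩)`. -/
def character (b ξ : EuclideanSpace ℝ (Fin n)) : ℂ := (𝐞 (inner ℝ b ξ) : ℂ)

theorem norm_character (b ξ : EuclideanSpace ℝ (Fin n)) : ‖character b ξ‖ = 1 :=
  Circle.norm_coe _

theorem continuous_character :
    Continuous fun p : EuclideanSpace ℝ (Fin n) × EuclideanSpace ℝ (Fin n) =>
      character p.1 p.2 := by
  unfold character
  exact continuous_subtype_val.comp (Real.continuous_fourierChar.comp
    (continuous_fst.inner continuous_snd))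

theorem memLp_character_mul (b : EuclideanSpace ℝ (Fin n)) {f : EuclideanSpace ℝ (Fin n) → ℂ}
    (hf : MemLp f 2 volume) : MemLp (fun ξ => character b ξ * f ξ) 2 volume :=
  hf.of_le ((continuous_character.comp (Continuous.prodMk_right b)).aestronglyMeasurable.mul hf.1)
    (.of_forall fun ξ => by rw [norm_mul, norm_character, one_mul])

/-- The modulation `f ↦ exp(2πi⟨b, ·⟩) f` on `L²(ℝⁿ)`. -/
def modulate (b : EuclideanSpace ℝ (Fin n)) : L2 n →L[ℂ] L2 n :=
  LinearMap.mkContinuous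
    { toFun := fun f => (memLp_character_mul b (Lp.memLp f)).toLp _
      map_add' := fun f g => by
        rw [← MemLp.toLp_add]
        refine MemLp.toLp_congr _ _ ?_
        filter_upwards [Lp.coeFn_add f g] with x hx
        rw [hx]
        simp [mul_add]
      map_smul' := fun c f => by
        rw [RingHom.id_apply, ← MemLp.toLp_const_smul]
        refine MemLp.toLp_congr _ _ ?_
        filter_upwards [Lp.coeFn_smul c f] with x hx
        rw [hx]
        simp [mul_left_comm] } 1 fun f => by
    rw [one_mul, LinearMap.coe_mk, AddHom.coe_mk, Lp.norm_toLp, Lp.norm_def]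
    refine ENNReal.toReal_mono (Lp.eLpNorm_ne_top f) (eLpNorm_mono fun ξ => ?_)
    rw [norm_mul, norm_character, one_mul]

theorem modulate_coeFn (b : EuclideanSpace ℝ (Fin n)) (f : L2 n) :
    modulate b f =ᵐ[volume] fun ξ => character b ξ * f ξ :=
  MemLp.coeFn_toLp (memLp_character_mul b (Lp.memLp f))

theorem translate_toLp (b : EuclideanSpace ℝ (Fin n)) (g : 𝓢(EuclideanSpace ℝ (Fin n), ℂ)) :
    translate b (g.toLp 2 volume) = (SchwartzMap.compSubConstCLM ℂ (-b) g).toLp 2 volume := by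
  apply Lp.ext
  refine (translate_coeFn b (g.coeFn_toLp 2 volume)).trans (Filter.EventuallyEq.trans
    (.of_forall fun t => ?_) (SchwartzMap.coeFn_toLp _ 2 volume).symm)
  simp

theorem fourier_compSubConst (b : EuclideanSpace ℝ (Fin n))
    (g : 𝓢(EuclideanSpace ℝ (Fin n), ℂ)) (ξ : EuclideanSpace ℝ (Fin n)) :
    𝓕 (SchwartzMap.compSubConstCLM ℂ (-b) g) ξ = character b ξ * 𝓕 g ξ := by
  have h4 : ⇑(SchwartzMap.compSubConstCLM ℂ (-b) g) = ⇑g ∘ fun v => v + b := by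
    ext v
    simp
  rw [SchwartzMap.fourier_coe, SchwartzMap.fourier_coe, h4]
  exact congrFun (VectorFourier.fourierIntegral_comp_add_right 𝐞 volume
    (innerₗ (EuclideanSpace ℝ (Fin n))) g b) ξ

theorem fourier_translate_toLp (b : EuclideanSpace ℝ (Fin n))
    (g : 𝓢(EuclideanSpace ℝ (Fin n), ℂ)) :
    𝓕 (translate b (g.toLp 2 volume)) = modulate b (𝓕 (g.toLp 2 volume)) := by
  rw [translate_toLp, SchwartzMap.toLp_fourier_eq, SchwartzMap.toLp_fourier_eq]
  apply Lp.ext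
  filter_upwards [modulate_coeFn b ((𝓕 g).toLp 2 volume), (𝓕 g).coeFn_toLp 2 volume,
    (𝓕 (SchwartzMap.compSubConstCLM ℂ (-b) g)).coeFn_toLp 2 volume] with ξ h1 h2 h3
  rw [h1, h2, h3, fourier_compSubConst]

/-- Both sides are continuous in `f`, and they agree on the dense range of the Schwartz functions.
-/
theorem fourier_translate (b : EuclideanSpace ℝ (Fin n)) (f : L2 n) :
    𝓕 (translate b f) = modulate b (𝓕 f) := by
  have hF : Continuous fun f : L2 n => 𝓕 f :=
    (Lp.fourierTransformₗᵢ (EuclideanSpace ℝ (Fin n)) ℂ).continuous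
  have hd : DenseRange (SchwartzMap.toLpCLM ℝ (E := EuclideanSpace ℝ (Fin n)) ℂ 2 volume) :=
    SchwartzMap.denseRange_toLpCLM ENNReal.ofNat_ne_top
  have hc : IsClosed {f : L2 n | 𝓕 (translate b f) = modulate b (𝓕 f)} :=
    isClosed_eq (hF.comp (translate b).continuous) ((modulate b).continuous.comp hF)
  exact hd.induction_on (p := fun f : L2 n => 𝓕 (translate b f) = modulate b (𝓕 f)) f hc
    (fourier_translate_toLp b)

end Fourier

/-! ### The spectral representation. -/

section Spectral

open scoped FourierTransform

variable {C : Matrix (Fin n) (Fin n) ℝ}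

/-- The Fourier transform of the logarithmic part in one hyperoctant. -/
def specPart (hC : C ∈ Matrix.orthogonalGroup (Fin n) ℝ) (σ : Fin n → ℤˣ) (f : L2 n) : L2 n :=
  𝓕 (logPart hC σ f)

theorem sum_norm_sq_specPart (hC : C ∈ Matrix.orthogonalGroup (Fin n) ℝ) (f : L2 n) :
    ∑ σ, ‖specPart hC σ f‖ ^ 2 = ‖f‖ ^ 2 := by
  simp only [specPart, Lp.norm_fourier_eq, sum_norm_sq_logPart]

theorem sum_inner_specPart (hC : C ∈ Matrix.orthogonalGroup (Fin n) ℝ) (f g : L2 n) :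
    ∑ σ, inner ℂ (specPart hC σ f) (specPart hC σ g) = inner ℂ f g := by
  let P : L2 n →ₗᵢ[ℂ] PiLp 2 fun _ : Fin n → ℤˣ => L2 n :=
    { toFun := fun f => WithLp.toLp 2 fun σ => logPart hC σ f
      map_add' := fun f g => by ext1 σ; simp
      map_smul' := fun c f => by ext1 σ; simp
      norm_map' := fun f => by
        refine (sq_eq_sq₀ (norm_nonneg _) (norm_nonneg _)).1 ?_
        rw [← sum_norm_sq_logPart hC, PiLp.norm_sq_eq_of_L2]
        rfl }
  have h := P.inner_map_map f g
  rw [PiLp.inner_apply] at h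
  rw [← h]
  exact Finset.sum_congr rfl fun σ _ => Lp.inner_fourier_eq _ _

/-- Surjectivity of the spectral representation, which supplies the test functions for the lower
norm bound. -/
theorem exists_specPart_eq (hC : C ∈ Matrix.orthogonalGroup (Fin n) ℝ)
    (h : (Fin n → ℤˣ) → L2 n) : ∃ f, ∀ σ, specPart hC σ f = h σ := by
  refine ⟨∑ σ, ofLogPart hC σ (𝓕⁻ (h σ)), fun τ => ?_⟩
  rw [specPart, map_sum]
  simp only [logPart_ofLogPart, Finset.sum_ite_eq, Finset.mem_univ, if_true]
  exact FourierTransform.fourier_fourierInv_eq (h τ)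

theorem specPart_dilation (hC : C ∈ Matrix.orthogonalGroup (Fin n) ℝ)
    {M : Matrix (Fin n) (Fin n) ℝ} {a : Fin n → ℝ}
    (hM : C.transpose * M * C = Matrix.diagonal a) {σ τ : Fin n → ℤˣ}
    (ha : ∀ k, Real.sign (a k) = (((σ k * τ k : ℤˣ) : ℤ) : ℝ)) (f : L2 n) :
    specPart hC σ (dilation M f) = modulate (logAbs (WithLp.toLp 2 a)) (specPart hC τ f) := by
  rw [specPart, logPart_dilation hC hM ha, fourier_translate, specPart]

end Spectral

/-! ### The Hausdorff operator as a matrix multiplier. -/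

section Symbol

variable {Ω : Type*} {A : Ω → Matrix (Fin n) (Fin n) ℝ} {C : Matrix (Fin n) (Fin n) ℝ}
  {a : Ω → Fin n → ℝ} {K : Ω → ℂ}

theorem Diagonalizes.mem_orthogonalGroup (h : Diagonalizes A C a) :
    C ∈ Matrix.orthogonalGroup (Fin n) ℝ := h.1

theorem Diagonalizes.apply_eq (h : Diagonalizes A C a) (u : Ω) (k : Fin n) :
    a u k = ∑ l, (∑ m, C m k * A u m l) * C l k := by
  have := congrFun (congrFun (h.2 u) k) k
  rw [Matrix.diagonal_apply_eq] at this
  rw [← this, Matrix.mul_apply]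
  rfl

theorem Diagonalizes.det_eq (h : Diagonalizes A C a) (u : Ω) : (A u).det = ∏ k, a u k := by
  rw [← Matrix.det_diagonal, ← h.2 u, Matrix.det_mul_right_comm, Matrix.det_mul,
    show C.transpose * C = 1 from (Matrix.mem_orthogonalGroup_iff' (Fin n) ℝ).1 h.1,
    Matrix.det_one, one_mul]

theorem sign_eq_intUnit_iff (x : ℝ) (s : ℤˣ) :
    Real.sign x = ((s : ℤ) : ℝ) ↔ 0 < ((s : ℤ) : ℝ) * x := by
  rcases Int.units_eq_one_or s with h | h <;> rcases lt_trichotomy x 0 with hx | hx | hx <;>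
    simp [h, hx, Real.sign_of_neg, Real.sign_of_pos] <;> norm_num <;> exact hx.le

theorem mem_signSet_iff (e : Fin (2 ^ n) ≃ (Fin n → ℤˣ)) (i j : Fin (2 ^ n)) (u : Ω) :
    u ∈ signSet e a i j ↔ a u ∈ octant (eps e i j) :=
  forall_congr' fun _ => sign_eq_intUnit_iff _ _

theorem ne_zero_of_mem_octant {x : Fin n → ℝ} {σ : Fin n → ℤˣ} (h : x ∈ octant σ) (k : Fin n) :
    x k ≠ 0 := fun h0 => by
  have := h k
  rw [h0, mul_zero] at this
  exact lt_irrefl _ this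

theorem eps_apply_symm_mul (e : Fin (2 ^ n) ≃ (Fin n → ℤˣ)) (i : Fin (2 ^ n)) (σ : Fin n → ℤˣ) :
    eps e i (e.symm (e i * σ)) = σ := by
  funext k
  rw [eps, Equiv.apply_symm_apply, Pi.mul_apply, ← mul_assoc, Int.units_mul_self, one_mul]

theorem eps_right_injective (e : Fin (2 ^ n) ≃ (Fin n → ℤˣ)) (i : Fin (2 ^ n)) :
    Function.Injective (eps e i) := fun _ _ h =>
  e.injective (funext fun k => mul_left_cancel (congrFun h k))

/-- For each `i` exactly one `j` satisfies `u ∈ Ω_{ij}`. The indicators encode this, so that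
integration over `u` can later be done on each `Ω_{ij}` separately. -/
theorem inner_dilation_eq_sum (h : Diagonalizes A C a) (e : Fin (2 ^ n) ≃ (Fin n → ℤˣ)) {u : Ω}
    (hu : (A u).det ≠ 0) (f g : L2 n) :
    inner ℂ g (dilation (A u) f) = ∑ i, ∑ j, (signSet e a i j).indicator
      (fun u => inner ℂ (specPart h.mem_orthogonalGroup (e i) g)
        (modulate (logAbs (WithLp.toLp 2 (a u))) (specPart h.mem_orthogonalGroup (e j) f))) u := by
  rw [← sum_inner_specPart h.mem_orthogonalGroup, ← e.sum_comp]
  refine Finset.sum_congr rfl fun i _ => ?_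
  rw [h.det_eq, Finset.prod_ne_zero_iff] at hu
  obtain ⟨σ, hσ⟩ := exists_mem_octant fun k => hu k (Finset.mem_univ k)
  have hmem : u ∈ signSet e a i (e.symm (e i * σ)) := by
    rwa [mem_signSet_iff, eps_apply_symm_mul]
  rw [Finset.sum_eq_single (e.symm (e i * σ)), Set.indicator_of_mem hmem,
    specPart_dilation h.mem_orthogonalGroup (h.2 u) hmem]
  · intro j _ hj
    refine Set.indicator_of_notMem (fun hm => hj ?_) _
    rw [mem_signSet_iff] at hm hmem
    exact eps_right_injective e i (octant_disjoint (x := WithLp.toLp 2 (a u)) hm hmem)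
  · simp

/-- The character is `exp(2πi⟨b, ξ⟩)`, so `ξ = -s/(2π)` produces the factor `|a|^{-is}`, while the
weight contributes `|a|^{-1/2}`. -/
theorem weight_mul_character (h : Diagonalizes A C a) {u : Ω} (hu : ∀ k, a u k ≠ 0)
    (s : EuclideanSpace ℝ (Fin n)) :
    weight K A u * character (logAbs (WithLp.toLp 2 (a u))) ((-(2 * Real.pi)⁻¹) • s)
      = K u * absPow (a u) s := by
  have hprod : |(A u).det| = Real.exp (∑ k, Real.log |a u k|) := by
    rw [h.det_eq, Finset.abs_prod, Real.exp_sum]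
    exact Finset.prod_congr rfl fun k _ => (Real.exp_log (abs_pos.2 (hu k))).symm
  have hpi : (Real.pi : ℂ) ≠ 0 := Complex.ofReal_ne_zero.2 Real.pi_ne_zero
  rw [weight, mul_comm _ (K u), mul_assoc]
  congr 1
  rw [hprod, ← Real.exp_mul, absPow, ← Complex.exp_sum, character, Real.fourierChar_apply,
    Complex.ofReal_exp, ← Complex.exp_add]
  congr 1
  rw [PiLp.inner_apply]
  simp only [logAbs, PiLp.smul_apply, smul_eq_mul, RCLike.inner_apply, conj_trivial]
  push_cast
  rw [Finset.sum_mul, Finset.mul_sum, Finset.sum_mul, ← Finset.sum_add_distrib]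
  refine Finset.sum_congr rfl fun k _ => ?_
  field_simp
  ring

variable [MeasurableSpace Ω] {μ : Measure Ω}

theorem symbol_apply (h : Diagonalizes A C a) (e : Fin (2 ^ n) ≃ (Fin n → ℤˣ))
    (hms : ∀ i j, NullMeasurableSet (signSet e a i j) μ)
    (s : EuclideanSpace ℝ (Fin n)) (i j : Fin (2 ^ n)) :
    symbol μ K e a s i j = ∫ u in signSet e a i j, weight K A u *
      character (logAbs (WithLp.toLp 2 (a u))) ((-(2 * Real.pi)⁻¹) • s) ∂μ := by
  refine integral_congr_ae ((ae_restrict_iff'₀ (hms i j)).2 (.of_forall fun u hu => ?_))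
  exact (weight_mul_character h (ne_zero_of_mem_octant ((mem_signSet_iff e i j u).1 hu)) s).symm

theorem Diagonalizes.aemeasurable (h : Diagonalizes A C a)
    (hA : ∀ k l, AEMeasurable (fun u => A u k l) μ) (k : Fin n) :
    AEMeasurable (fun u => a u k) μ := by
  simp only [h.apply_eq]
  exact Finset.aemeasurable_fun_sum _ fun l _ => (Finset.aemeasurable_fun_sum _ fun m _ =>
    (hA m l).const_mul _).mul_const _

theorem nullMeasurableSet_signSet (ha : ∀ k, AEMeasurable (fun u => a u k) μ)
    (e : Fin (2 ^ n) ≃ (Fin n → ℤˣ)) (i j : Fin (2 ^ n)) :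
    NullMeasurableSet (signSet e a i j) μ := by
  have : signSet e a i j = ⋂ k, {u | 0 < ((eps e i j k : ℤ) : ℝ) * a u k} := by
    ext u
    rw [mem_signSet_iff]
    simp [octant]
  rw [this]
  exact NullMeasurableSet.iInter fun k =>
    nullMeasurableSet_lt aemeasurable_const ((ha k).const_mul _)

theorem aemeasurable_logAbs (ha : ∀ k, AEMeasurable (fun u => a u k) μ) :
    AEMeasurable (fun u => logAbs (WithLp.toLp 2 (a u))) μ :=
  measurable_logAbs.comp_aemeasurable
    ((WithLp.measurable_toLp 2 (Fin n → ℝ)).comp_aemeasurable (aemeasurable_pi_iff.2 ha))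

theorem continuous_integral_character {w : Ω → ℂ} (hw : Integrable w μ)
    {b : Ω → EuclideanSpace ℝ (Fin n)} (hb : AEMeasurable b μ) :
    Continuous fun ξ => ∫ u, w u * character (b u) ξ ∂μ := by
  refine continuous_of_dominated (bound := fun u => ‖w u‖) (fun ξ => ?_) (fun ξ => ?_) hw.norm ?_
  · exact hw.1.mul ((continuous_character.comp
      (Continuous.prodMk_left ξ)).comp_aestronglyMeasurable hb.aestronglyMeasurable)
  · exact .of_forall fun u => by rw [norm_mul, norm_character, mul_one]
  · exact .of_forall fun u => continuous_const.mul
      (continuous_character.comp (Continuous.prodMk_right (b u)))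

theorem continuous_symbol_apply (hadm : IsAdmissible μ K A) (h : Diagonalizes A C a)
    (e : Fin (2 ^ n) ≃ (Fin n → ℤˣ)) (i j : Fin (2 ^ n)) :
    Continuous fun s => symbol μ K e a s i j := by
  have ha := h.aemeasurable hadm.aemeasurable
  simp only [symbol_apply h e (nullMeasurableSet_signSet ha e)]
  exact (continuous_integral_character (hadm.integrable_weight.restrict)
    (aemeasurable_logAbs ha).restrict).comp (continuous_const_smul _)

theorem integrable_prod_character [SFinite μ] {w : Ω → ℂ} (hw : Integrable w μ)
    {b : Ω → EuclideanSpace ℝ (Fin n)} (hb : AEMeasurable b μ)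
    {G : EuclideanSpace ℝ (Fin n) → ℂ} (hG : Integrable G volume) :
    Integrable (fun z : Ω × EuclideanSpace ℝ (Fin n) => w z.1 * character (b z.1) z.2 * G z.2)
      (μ.prod volume) := by
  have hb' : AEMeasurable (fun z : Ω × EuclideanSpace ℝ (Fin n) => (b z.1, z.2))
      (μ.prod volume) := hb.comp_fst.prodMk measurable_snd.aemeasurable
  have hc : AEStronglyMeasurable (fun z : Ω × EuclideanSpace ℝ (Fin n) =>
      character (b z.1) z.2) (μ.prod volume) :=
    (continuous_character.measurable.comp_aemeasurable hb').aestronglyMeasurable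
  refine ((hw.mul_prod hG).bdd_mul (c := 1) hc
    (.of_forall fun z => (norm_character _ _).le)).congr (.of_forall fun z => ?_)
  change character (b z.1) z.2 * (w z.1 * G z.2) = _
  ring

/-- Integrating a family of modulations against a weight gives a Fourier multiplier. -/
theorem integral_weight_inner_modulate [SFinite μ] {w : Ω → ℂ} (hw : Integrable w μ)
    {b : Ω → EuclideanSpace ℝ (Fin n)} (hb : AEMeasurable b μ) (p q : L2 n) :
    Integrable (fun u => w u * inner ℂ q (modulate (b u) p)) μ ∧
    Integrable (fun ξ => (∫ u, w u * character (b u) ξ ∂μ) * inner ℂ (q ξ) (p ξ)) volume ∧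
    ∫ u, w u * inner ℂ q (modulate (b u) p) ∂μ
      = ∫ ξ, (∫ u, w u * character (b u) ξ ∂μ) * inner ℂ (q ξ) (p ξ) := by
  have h1 := integrable_prod_character hw hb (L2.integrable_inner (𝕜 := ℂ) q p)
  have h2 : ∀ u, w u * inner ℂ q (modulate (b u) p)
      = ∫ ξ, w u * character (b u) ξ * inner ℂ (q ξ) (p ξ) := fun u => by
    rw [L2.inner_def, ← integral_const_mul]
    refine integral_congr_ae ?_
    filter_upwards [modulate_coeFn (b u) p] with ξ hξ
    rw [hξ, RCLike.inner_apply, RCLike.inner_apply]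
    ring
  simp only [h2, ← integral_mul_const]
  exact ⟨h1.integral_prod_left, h1.integral_prod_right, integral_integral_swap h1⟩

/-- The vector of the spectral parts of `f` at a frequency. -/
def specVec (hC : C ∈ Matrix.orthogonalGroup (Fin n) ℝ) (e : Fin (2 ^ n) ≃ (Fin n → ℤˣ))
    (f : L2 n) (ξ : EuclideanSpace ℝ (Fin n)) : EuclideanSpace ℂ (Fin (2 ^ n)) :=
  WithLp.toLp 2 fun i => specPart hC (e i) f ξ

theorem inner_toEuclideanCLM {N : ℕ} (M : Matrix (Fin N) (Fin N) ℂ)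
    (v w : EuclideanSpace ℂ (Fin N)) :
    inner ℂ w (Matrix.toEuclideanCLM (n := Fin N) (𝕜 := ℂ) M v)
      = ∑ i, ∑ j, M i j * inner ℂ (w i) (v j) := by
  rw [PiLp.inner_apply]
  refine Finset.sum_congr rfl fun i _ => ?_
  simp only [Matrix.ofLp_toEuclideanCLM, Matrix.mulVec, dotProduct, RCLike.inner_apply,
    Finset.sum_mul, mul_assoc]

/-- In the spectral representation each dilation is a signed permutation of the hyperoctants
combined with a modulation. Integrating the modulations over `Ω_{ij}` gives, by Fubini,
multiplication by the entry `φ_{ij}`. -/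
theorem inner_hausdorff_eq_integral [SFinite μ] (hadm : IsAdmissible μ K A)
    (h : Diagonalizes A C a) (e : Fin (2 ^ n) ≃ (Fin n → ℤˣ)) {H : L2 n →L[ℂ] L2 n}
    (hH : ∀ f g : L2 n, inner ℂ g (H f) = ∫ u, weight K A u * inner ℂ g (dilation (A u) f) ∂μ)
    (f g : L2 n) :
    inner ℂ g (H f) = ∫ ξ, inner ℂ (specVec h.mem_orthogonalGroup e g ξ)
      (Matrix.toEuclideanCLM (n := Fin (2 ^ n)) (𝕜 := ℂ)
        (symbol μ K e a ((-(2 * Real.pi)) • ξ)) (specVec h.mem_orthogonalGroup e f ξ)) := by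
  have ha := h.aemeasurable hadm.aemeasurable
  have hms := nullMeasurableSet_signSet ha e
  have hsym : ∀ ξ i j, symbol μ K e a ((-(2 * Real.pi)) • ξ) i j
      = ∫ u in signSet e a i j, weight K A u * character (logAbs (WithLp.toLp 2 (a u))) ξ ∂μ :=
    fun ξ i j => by
      rw [symbol_apply h e hms, smul_smul, neg_mul_neg, inv_mul_cancel₀ (by positivity), one_smul]
  have key := fun i j => integral_weight_inner_modulate (μ := μ.restrict (signSet e a i j))
    (hadm.integrable_weight.restrict) (aemeasurable_logAbs ha).restrict
    (specPart h.mem_orthogonalGroup (e j) f) (specPart h.mem_orthogonalGroup (e i) g)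
  simp only [inner_toEuclideanCLM, hsym, specVec]
  rw [hH]
  refine Eq.trans ?_ (integral_finsetSum _ fun i _ => integrable_finsetSum _ fun j _ =>
    (key i j).2.1).symm
  have hu : ∀ᵐ u ∂μ, weight K A u * inner ℂ g (dilation (A u) f)
      = ∑ i, ∑ j, (signSet e a i j).indicator (fun u => weight K A u *
        inner ℂ (specPart h.mem_orthogonalGroup (e i) g)
          (modulate (logAbs (WithLp.toLp 2 (a u))) (specPart h.mem_orthogonalGroup (e j) f))) u := by
    filter_upwards [hadm.nonsing] with u hu
    by_cases hK : K u = 0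
    · have hw : weight K A u = 0 := by simp [weight, hK]
      rw [hw, zero_mul]
      refine (Finset.sum_eq_zero fun i _ => Finset.sum_eq_zero fun j _ => ?_).symm
      by_cases hmem : u ∈ signSet e a i j <;> simp [hmem, hw]
    · rw [inner_dilation_eq_sum h e (hu hK), Finset.mul_sum]
      refine Finset.sum_congr rfl fun i _ => ?_
      rw [Finset.mul_sum]
      refine Finset.sum_congr rfl fun j _ => ?_
      by_cases hmem : u ∈ signSet e a i j <;> simp [hmem]
  have hint := fun i j => IntegrableOn.integrable_indicator₀ (key i j).1 (hms i j)
  rw [integral_congr_ae hu, integral_finsetSum _ fun i _ => integrable_finsetSum _ fun j _ => hint i j]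
  refine Finset.sum_congr rfl fun i _ => ?_
  rw [integral_finsetSum _ fun j _ => hint i j, integral_finsetSum _ fun j _ => (key i j).2.1]
  refine Finset.sum_congr rfl fun j _ => ?_
  rw [integral_indicator₀ (hms i j)]
  exact (key i j).2.2

end Symbol

/-! ### Approximate eigenvalues of a bounded family of normal matrices. -/

section NormalFamily

variable {N : ℕ}

theorem det_eq_zero_iff_mem_spectrum (M : Matrix (Fin N) (Fin N) ℂ) (l : ℂ) :
    (l • (1 : Matrix (Fin N) (Fin N) ℂ) - M).det = 0 ↔
      l ∈ spectrum ℂ (Matrix.toEuclideanCLM (n := Fin N) (𝕜 := ℂ) M) := by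
  rw [AlgEquiv.spectrum_eq, spectrum.mem_iff, Matrix.isUnit_iff_isUnit_det, isUnit_iff_ne_zero,
    not_not, Algebra.algebraMap_eq_smul_one]

theorem continuous_det_symm_toEuclideanCLM (l : ℂ) :
    Continuous fun T : EuclideanSpace ℂ (Fin N) →L[ℂ] EuclideanSpace ℂ (Fin N) =>
      (l • (1 : Matrix (Fin N) (Fin N) ℂ)
        - (Matrix.toEuclideanCLM (n := Fin N) (𝕜 := ℂ)).symm T).det := by
  have h : Continuous (Matrix.toEuclideanCLM (n := Fin N) (𝕜 := ℂ)).symm :=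
    LinearMap.continuous_of_finiteDimensional
      ((Matrix.toEuclideanCLM (n := Fin N) (𝕜 := ℂ)).symm.toAlgEquiv.toLinearMap)
  exact (continuous_const.sub h).matrix_det

theorem isClosed_setOf_isStarNormal {R : Type*} [Mul R] [Star R] [TopologicalSpace R] [T2Space R]
    [ContinuousMul R] [ContinuousStar R] : IsClosed {x : R | IsStarNormal x} := by
  simp only [isStarNormal_iff, commute_iff_eq]
  exact isClosed_eq (continuous_star.mul continuous_id) (continuous_id.mul continuous_star)

/-- For a family of normal matrices, the supremum of the norms is the largest modulus of an
approximate eigenvalue of the family. -/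
theorem isGreatest_of_isLUB_norm [NeZero N] {S : Type*} [Nonempty S]
    {Φ : S → Matrix (Fin N) (Fin N) ℂ} (hΦ : ∀ s, IsStarNormal (Φ s)) {R : ℝ}
    (hR : IsLUB (Set.range fun s => ‖Matrix.toEuclideanCLM (n := Fin N) (𝕜 := ℂ) (Φ s)‖) R) :
    IsGreatest {r : ℝ | ∃ l : ℂ,
      (⨅ s, ‖(l • (1 : Matrix (Fin N) (Fin N) ℂ) - Φ s).det‖) = 0 ∧ r = ‖l‖} R := by
  let T : S → EuclideanSpace ℂ (Fin N) →L[ℂ] EuclideanSpace ℂ (Fin N) := fun s =>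
    Matrix.toEuclideanCLM (n := Fin N) (𝕜 := ℂ) (Φ s)
  let D : ℂ → (EuclideanSpace ℂ (Fin N) →L[ℂ] EuclideanSpace ℂ (Fin N)) → ℝ := fun l X =>
    ‖(l • (1 : Matrix (Fin N) (Fin N) ℂ)
      - (Matrix.toEuclideanCLM (n := Fin N) (𝕜 := ℂ)).symm X).det‖
  have hDc : ∀ l, Continuous (D l) := fun l => (continuous_det_symm_toEuclideanCLM l).norm
  have hD0 : ∀ l X, D l X = 0 ↔ l ∈ spectrum ℂ X := fun l X => by
    rw [norm_eq_zero, det_eq_zero_iff_mem_spectrum, StarAlgEquiv.apply_symm_apply]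
  have hDT : ∀ l s, ‖(l • (1 : Matrix (Fin N) (Fin N) ℂ) - Φ s).det‖ = D l (T s) := fun l s => by
    simp only [D, T, StarAlgEquiv.symm_apply_apply]
  have hbdd : ∀ l, BddBelow (Set.range fun s => D l (T s)) := fun l =>
    ⟨0, by rintro _ ⟨s, rfl⟩; exact norm_nonneg _⟩
  have hball : closure (Set.range T) ⊆ Metric.closedBall 0 R := by
    refine closure_minimal ?_ Metric.isClosed_closedBall
    rintro _ ⟨s, rfl⟩
    rw [mem_closedBall_zero_iff]
    exact hR.1 ⟨s, rfl⟩
  have hcomp : IsCompact (closure (Set.range T)) :=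
    (isCompact_closedBall _ _).of_isClosed_subset isClosed_closure hball
  have hne : (closure (Set.range T)).Nonempty := (Set.range_nonempty T).closure
  simp only [hDT]
  constructor
  -- A matrix of maximal norm in the compact closure is a limit of normal ones, hence normal, and so
  -- has an eigenvalue of modulus `R`. By continuity of the determinant this is an approximate
  -- eigenvalue of the family.
  · obtain ⟨X, hX, hmax⟩ := hcomp.exists_isMaxOn hne continuous_norm.continuousOn
    have hXR : ‖X‖ = R := by
      refine le_antisymm (mem_closedBall_zero_iff.1 (hball hX)) (hR.2 ?_)
      rintro _ ⟨s, rfl⟩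
      exact hmax (subset_closure ⟨s, rfl⟩)
    have : ContinuousStar (EuclideanSpace ℂ (Fin N) →L[ℂ] EuclideanSpace ℂ (Fin N)) :=
      ⟨(ContinuousLinearMap.adjoint (𝕜 := ℂ) (E := EuclideanSpace ℂ (Fin N))
        (F := EuclideanSpace ℂ (Fin N))).continuous⟩
    have : IsStarNormal X := by
      refine closure_minimal ?_ isClosed_setOf_isStarNormal hX
      rintro _ ⟨s, rfl⟩
      exact (hΦ s).map (Matrix.toEuclideanCLM (n := Fin N) (𝕜 := ℂ))
    obtain ⟨l, hl, hlr⟩ := spectrum.exists_nnnorm_eq_spectralRadius X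
    rw [IsStarNormal.spectralRadius_eq_nnnorm, ENNReal.coe_inj] at hlr
    refine ⟨l, le_antisymm (le_of_forall_pos_lt_add fun ε hε => ?_)
      (Real.iInf_nonneg fun s => norm_nonneg _), ?_⟩
    · have hopen : IsOpen {Y | D l Y < ε} := isOpen_lt (hDc l) continuous_const
      have hmem : X ∈ {Y | D l Y < ε} := by
        rw [Set.mem_ofPred_eq, (hD0 l X).2 hl]
        exact hε
      obtain ⟨_, hY, s, rfl⟩ := mem_closure_iff.1 hX _ hopen hmem
      rw [zero_add]
      exact (ciInf_le (hbdd l) s).trans_lt hY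
    · rw [← hXR, ← coe_nnnorm, ← coe_nnnorm, hlr]
  · rintro _ ⟨l, hl, rfl⟩
    -- Conversely, infimum zero forces the determinant to vanish at some `X` of the closure, so `l`
    -- is an eigenvalue of a matrix of norm at most `R`.
    obtain ⟨X, hX, hmin⟩ := hcomp.exists_isMinOn hne (hDc l).continuousOn
    have h0 : D l X ≤ 0 := by
      rw [← hl]
      exact le_ciInf fun s => hmin (subset_closure ⟨s, rfl⟩)
    have hspec := (hD0 l X).1 (le_antisymm h0 (norm_nonneg _))
    exact (spectrum.norm_le_norm_of_mem hspec).trans (mem_closedBall_zero_iff.1 (hball hX))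

end NormalFamily

/-! ### Normality of the symbol and the two norm bounds. -/

section NormBounds

variable {Ω : Type*} {A : Ω → Matrix (Fin n) (Fin n) ℝ} {C : Matrix (Fin n) (Fin n) ℝ}
  {a : Ω → Fin n → ℝ} {K : Ω → ℂ} [MeasurableSpace Ω] {μ : Measure Ω}

theorem symbol_congr {e : Fin (2 ^ n) ≃ (Fin n → ℤˣ)} {i j k l : Fin (2 ^ n)}
    (h : eps e i j = eps e k l) (s : EuclideanSpace ℝ (Fin n)) :
    symbol μ K e a s i j = symbol μ K e a s k l := by
  simp only [symbol, Matrix.of_apply, signSet, h]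

/-- Entries depend only on the product of the two sign vectors. In the sum over `j` for the entry
`(i, k)`, the involution `j ↦ j·i·k` of the group exchanges the two factors. -/
theorem isStarNormal_symbol (e : Fin (2 ^ n) ≃ (Fin n → ℤˣ)) (s : EuclideanSpace ℝ (Fin n)) :
    IsStarNormal (symbol μ K e a s) := by
  refine ⟨?_⟩
  ext i k
  rw [Matrix.mul_apply, Matrix.mul_apply]
  have hinv : Function.Involutive fun j => e.symm (e j * (e i * e k)) := fun j => by
    simp only [Equiv.apply_symm_apply]
    rw [mul_assoc, show e i * e k * (e i * e k) = 1 from funext fun _ => Int.units_mul_self _,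
      mul_one, Equiv.symm_apply_apply]
  rw [← hinv.toPerm.sum_comp _ _ (by simp)]
  refine Finset.sum_congr rfl fun j _ => ?_
  simp only [Matrix.star_apply, Function.Involutive.coe_toPerm]
  have h1 : eps e (e.symm (e j * (e i * e k))) i = eps e k j := by
    funext m
    simp only [eps, Equiv.apply_symm_apply, Pi.mul_apply]
    rw [mul_comm (e k m), mul_assoc, mul_right_comm, Int.units_mul_self, one_mul]
  have h2 : eps e (e.symm (e j * (e i * e k))) k = eps e i j := by
    funext m
    simp only [eps, Equiv.apply_symm_apply, Pi.mul_apply]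
    rw [← mul_assoc, mul_assoc, Int.units_mul_self, mul_one, mul_comm]
  rw [symbol_congr h1, symbol_congr h2, mul_comm]

theorem integral_norm_sq (f : L2 n) :
    Integrable (fun ξ => ‖f ξ‖ ^ 2) volume ∧ ∫ ξ, ‖f ξ‖ ^ 2 = ‖f‖ ^ 2 := by
  refine ⟨(Lp.memLp f).integrable_norm_pow two_ne_zero, ?_⟩
  have h := inner_self_eq_norm_sq_to_K (𝕜 := ℂ) f
  rw [L2.inner_def] at h
  simp only [inner_self_eq_norm_sq_to_K] at h
  have h2 : ((∫ ξ, ‖f ξ‖ ^ 2 : ℝ) : ℂ) = ((‖f‖ ^ 2 : ℝ) : ℂ) := by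
    rw [← integral_complex_ofReal]
    push_cast
    exact h
  exact_mod_cast h2

theorem integral_norm_sq_specVec (hC : C ∈ Matrix.orthogonalGroup (Fin n) ℝ)
    (e : Fin (2 ^ n) ≃ (Fin n → ℤˣ)) (f : L2 n) :
    Integrable (fun ξ => ‖specVec hC e f ξ‖ ^ 2) volume ∧
      ∫ ξ, ‖specVec hC e f ξ‖ ^ 2 = ‖f‖ ^ 2 := by
  simp only [EuclideanSpace.norm_sq_eq, specVec]
  refine ⟨integrable_finsetSum _ fun i _ => (integral_norm_sq _).1, ?_⟩
  rw [integral_finsetSum _ fun i _ => (integral_norm_sq _).1, ← sum_norm_sq_specPart hC,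
    ← e.sum_comp]
  exact Finset.sum_congr rfl fun i _ => (integral_norm_sq _).2

/-- The arithmetic mean of the squares replaces the product of the norms, so a pointwise bound can
be integrated directly, without Cauchy–Schwarz for the integrals. -/
theorem opNorm_le_of_inner_le {X : Type*} [NormedAddCommGroup X] [InnerProductSpace ℂ X]
    {H : X →L[ℂ] X} {M : ℝ} (hM : 0 ≤ M)
    (h : ∀ f g, ‖(inner ℂ g (H f) : ℂ)‖ ≤ M * ((‖g‖ ^ 2 + ‖f‖ ^ 2) / 2)) : ‖H‖ ≤ M := by
  refine H.opNorm_le_bound hM fun f => ?_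
  by_cases hf : f = 0
  · simp [hf]
  by_cases hH : H f = 0
  · rw [hH, norm_zero]; positivity
  have hf' : 0 < ‖f‖ := norm_pos_iff.2 hf
  have hH' : 0 < ‖H f‖ := norm_pos_iff.2 hH
  -- The scaling gives the test vector the norm of `f`, where the mean equals the product.
  have h1 := h f (((‖f‖ / ‖H f‖ : ℝ) : ℂ) • H f)
  rw [inner_smul_left, norm_smul, norm_mul, RCLike.norm_conj, Complex.norm_real,
    Real.norm_of_nonneg (by positivity), inner_self_eq_norm_sq_to_K, norm_pow] at h1
  simp only [Complex.coe_algebraMap, Complex.norm_real, norm_norm] at h1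
  rw [div_mul_cancel₀ _ hH'.ne', div_mul_eq_mul_div, div_le_iff₀ hH'] at h1
  have h3 : (‖f‖ * ‖H f‖) * ‖H f‖ ≤ (‖f‖ * ‖H f‖) * (M * ‖f‖) := by linarith
  exact le_of_mul_le_mul_left h3 (by positivity)

theorem opNorm_le_of_norm_symbol_le [SFinite μ] (hadm : IsAdmissible μ K A)
    (h : Diagonalizes A C a) (e : Fin (2 ^ n) ≃ (Fin n → ℤˣ)) {H : L2 n →L[ℂ] L2 n}
    (hH : ∀ f g : L2 n, inner ℂ g (H f) = ∫ u, weight K A u * inner ℂ g (dilation (A u) f) ∂μ)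
    {M : ℝ} (hM : ∀ s, ‖Matrix.toEuclideanCLM (n := Fin (2 ^ n)) (𝕜 := ℂ)
      (symbol μ K e a s)‖ ≤ M) : ‖H‖ ≤ M := by
  have hM0 : 0 ≤ M := (norm_nonneg _).trans (hM 0)
  refine opNorm_le_of_inner_le hM0 fun f g => ?_
  obtain ⟨hf, hf'⟩ := integral_norm_sq_specVec h.mem_orthogonalGroup e f
  obtain ⟨hg, hg'⟩ := integral_norm_sq_specVec h.mem_orthogonalGroup e g
  rw [inner_hausdorff_eq_integral hadm h e hH, ← hf', ← hg', ← integral_add hg hf,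
    ← integral_div, ← integral_const_mul]
  refine norm_integral_le_of_norm_le (((hg.add hf).div_const 2).const_mul M)
    (.of_forall fun ξ => ?_)
  refine (norm_inner_le_norm _ _).trans ?_
  have h1 := ContinuousLinearMap.le_of_opNorm_le _ (hM ((-(2 * Real.pi)) • ξ))
    (specVec h.mem_orthogonalGroup e f ξ)
  have h2 : 2 * (‖specVec h.mem_orthogonalGroup e g ξ‖ * ‖specVec h.mem_orthogonalGroup e f ξ‖)
      ≤ ‖specVec h.mem_orthogonalGroup e g ξ‖ ^ 2 + ‖specVec h.mem_orthogonalGroup e f ξ‖ ^ 2 := by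
    rw [← mul_assoc]
    exact two_mul_le_add_sq _ _
  calc _ ≤ ‖specVec h.mem_orthogonalGroup e g ξ‖ * (M * ‖specVec h.mem_orthogonalGroup e f ξ‖) := by
        gcongr
    _ = M * (2 * (‖specVec h.mem_orthogonalGroup e g ξ‖ *
          ‖specVec h.mem_orthogonalGroup e f ξ‖) / 2) := by ring
    _ ≤ _ := by gcongr

/-- The averages of a continuous function over shrinking balls converge to its value at the centre.
-/
theorem norm_le_of_norm_setIntegral_ball_le {G : EuclideanSpace ℝ (Fin n) → ℂ}
    (hG : Continuous G) (x : EuclideanSpace ℝ (Fin n)) {c : ℝ}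
    (h : ∀ r > 0, ‖∫ ξ in Metric.ball x r, G ξ‖ ≤ c * volume.real (Metric.ball x r)) :
    ‖G x‖ ≤ c := by
  refine le_of_forall_pos_le_add fun ε hε => ?_
  obtain ⟨r, hr, hball⟩ := Metric.continuous_iff.1 hG x ε hε
  have hvol : 0 < volume.real (Metric.ball x r) :=
    ENNReal.toReal_pos (Metric.measure_ball_pos volume x hr).ne' measure_ball_lt_top.ne
  have hint : IntegrableOn G (Metric.ball x r) volume :=
    (hG.continuousOn.integrableOn_compact (isCompact_closedBall x r)).mono_set
      Metric.ball_subset_closedBall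
  have hconst : IntegrableOn (fun _ => G x) (Metric.ball x r) volume :=
    integrableOn_const measure_ball_lt_top.ne
  have h1 : ‖∫ ξ in Metric.ball x r, (G ξ - G x)‖ ≤ ε * volume.real (Metric.ball x r) :=
    norm_setIntegral_le_of_norm_le_const measure_ball_lt_top fun ξ hξ => by
      rw [← dist_eq_norm]
      exact (hball ξ hξ).le
  rw [integral_sub hint hconst, setIntegral_const] at h1
  have h2 := h r hr
  have h3 : ‖volume.real (Metric.ball x r) • G x‖ ≤
      c * volume.real (Metric.ball x r) + ε * volume.real (Metric.ball x r) := by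
    rw [norm_sub_rev] at h1
    have := norm_le_norm_add_norm_sub' (volume.real (Metric.ball x r) • G x)
      (∫ ξ in Metric.ball x r, G ξ)
    linarith
  rw [norm_smul, Real.norm_of_nonneg hvol.le, ← add_mul, mul_comm] at h3
  exact le_of_mul_le_mul_right h3 hvol

/-- Every vector is the spectral vector of a function, localized to a set of finite measure. -/
theorem exists_specVec_eq_indicator (hC : C ∈ Matrix.orthogonalGroup (Fin n) ℝ)
    (e : Fin (2 ^ n) ≃ (Fin n → ℤˣ)) {B : Set (EuclideanSpace ℝ (Fin n))} (hB : MeasurableSet B)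
    (hB' : volume B ≠ ∞) (v : EuclideanSpace ℂ (Fin (2 ^ n))) :
    ∃ f : L2 n, specVec hC e f =ᵐ[volume] B.indicator (fun _ => v) := by
  obtain ⟨f, hf⟩ := exists_specPart_eq hC fun σ => indicatorConstLp 2 hB hB' (v (e.symm σ))
  refine ⟨f, ?_⟩
  have : ∀ i, specPart hC (e i) f =ᵐ[volume] B.indicator fun _ => v i := fun i => by
    rw [hf, Equiv.symm_apply_apply]
    exact indicatorConstLp_coeFn
  filter_upwards [ae_all_iff.2 this] with ξ hξ
  ext i
  rw [specVec]
  simp only [hξ]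
  by_cases h : ξ ∈ B <;> simp [h]

theorem norm_sq_of_specVec_eq_indicator {hC : C ∈ Matrix.orthogonalGroup (Fin n) ℝ}
    {e : Fin (2 ^ n) ≃ (Fin n → ℤˣ)} {B : Set (EuclideanSpace ℝ (Fin n))} (hB : MeasurableSet B)
    {v : EuclideanSpace ℂ (Fin (2 ^ n))} {f : L2 n}
    (hf : specVec hC e f =ᵐ[volume] B.indicator (fun _ => v)) :
    ‖f‖ ^ 2 = volume.real B * ‖v‖ ^ 2 := by
  rw [← (integral_norm_sq_specVec hC e f).2]
  have : (fun ξ => ‖specVec hC e f ξ‖ ^ 2) =ᵐ[volume] B.indicator fun _ => ‖v‖ ^ 2 := by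
    filter_upwards [hf] with ξ hξ
    rw [hξ]
    by_cases h : ξ ∈ B <;> simp [h]
  rw [integral_congr_ae this, integral_indicator hB, setIntegral_const, smul_eq_mul]

/-- Functions whose spectral vectors are constant on a small ball around the frequency `-s/(2π)` and
vanish elsewhere make `H` act nearly as `Φ(s)`; continuity of the symbol lets the ball shrink. -/
theorem norm_symbol_le_opNorm [SFinite μ] (hadm : IsAdmissible μ K A)
    (h : Diagonalizes A C a) (e : Fin (2 ^ n) ≃ (Fin n → ℤˣ)) {H : L2 n →L[ℂ] L2 n}
    (hH : ∀ f g : L2 n, inner ℂ g (H f) = ∫ u, weight K A u * inner ℂ g (dilation (A u) f) ∂μ)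
    (s : EuclideanSpace ℝ (Fin n)) :
    ‖Matrix.toEuclideanCLM (n := Fin (2 ^ n)) (𝕜 := ℂ) (symbol μ K e a s)‖ ≤ ‖H‖ := by
  let Φ := fun s => Matrix.toEuclideanCLM (n := Fin (2 ^ n)) (𝕜 := ℂ) (symbol μ K e a s)
  suffices key : ∀ v y : EuclideanSpace ℂ (Fin (2 ^ n)),
      ‖(inner ℂ y (Φ s v) : ℂ)‖ ≤ ‖H‖ * (‖y‖ * ‖v‖) by
    refine (Φ s).opNorm_le_bound (norm_nonneg _) fun v => ?_
    by_cases hv : Φ s v = 0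
    · rw [hv, norm_zero]; positivity
    have h1 := key v (Φ s v)
    rw [inner_self_eq_norm_sq_to_K, norm_pow, RCLike.norm_ofReal, abs_norm] at h1
    have h2 : ‖Φ s v‖ * ‖Φ s v‖ ≤ ‖Φ s v‖ * (‖H‖ * ‖v‖) := by linarith
    exact le_of_mul_le_mul_left h2 (norm_pos_iff.2 hv)
  intro v y
  let G : EuclideanSpace ℝ (Fin n) → ℂ := fun ξ => inner ℂ y (Φ ((-(2 * Real.pi)) • ξ) v)
  have hG : Continuous G := by
    simp only [G, Φ, inner_toEuclideanCLM]
    exact continuous_finsetSum _ fun i _ => continuous_finsetSum _ fun j _ =>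
      ((continuous_symbol_apply hadm h e i j).comp (continuous_const_smul _)).mul continuous_const
  have hx : G ((-(2 * Real.pi)⁻¹) • s) = inner ℂ y (Φ s v) := by
    simp only [G]
    rw [smul_smul, neg_mul_neg, mul_inv_cancel₀ (by positivity), one_smul]
  rw [← hx]
  refine norm_le_of_norm_setIntegral_ball_le hG _ fun r hr => ?_
  set B := Metric.ball ((-(2 * Real.pi)⁻¹) • s) r
  have hB : MeasurableSet B := measurableSet_ball
  obtain ⟨f, hf⟩ := exists_specVec_eq_indicator h.mem_orthogonalGroup e hB
    measure_ball_lt_top.ne v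
  obtain ⟨g, hg⟩ := exists_specVec_eq_indicator h.mem_orthogonalGroup e hB
    measure_ball_lt_top.ne y
  have hfn := norm_sq_of_specVec_eq_indicator hB hf
  have hgn := norm_sq_of_specVec_eq_indicator hB hg
  have hint : inner ℂ g (H f) = ∫ ξ in B, G ξ := by
    rw [inner_hausdorff_eq_integral hadm h e hH, ← integral_indicator hB]
    refine integral_congr_ae ?_
    filter_upwards [hf, hg] with ξ h1 h2
    rw [h1, h2]
    by_cases hξ : ξ ∈ B <;> simp [hξ, G, Φ]
  rw [← hint]
  have hnorm : ‖g‖ * ‖f‖ = ‖y‖ * ‖v‖ * volume.real B := by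
    refine (sq_eq_sq₀ (by positivity) (by positivity)).1 ?_
    rw [mul_pow, hfn, hgn]
    ring
  calc ‖(inner ℂ g (H f) : ℂ)‖ ≤ ‖g‖ * ‖H f‖ := norm_inner_le_norm _ _
    _ ≤ ‖g‖ * (‖H‖ * ‖f‖) := by gcongr; exact H.le_opNorm f
    _ = ‖H‖ * (‖g‖ * ‖f‖) := by ring
    _ = ‖H‖ * (‖y‖ * ‖v‖) * volume.real B := by rw [hnorm]; ring

end NormBounds

end Hausdorff

end

/-! ### The norm formula. -/

theorem corollary3 {n : ℕ} {Ω : Type*} [TopologicalSpace Ω] [SigmaCompactSpace Ω]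
    [MeasurableSpace Ω] [BorelSpace Ω] (μ : Measure Ω) [μ.Regular]
    (K : Ω → ℂ) (hK : LocallyIntegrable K μ)
    (A : Ω → Matrix (Fin n) (Fin n) ℝ)
    (hA_meas : ∀ k l, AEMeasurable (fun u => A u k l) μ)
    (hA_nonsing : ∀ᵐ u ∂μ, K u ≠ 0 → (A u).det ≠ 0)
    (hA_comm : ∀ u v, Commute (A u) (A v))
    (hA_selfadj : ∀ u, (A u).IsHermitian)
    (hKA : Integrable (fun u => ((|(A u).det| ^ (-(1 / 2) : ℝ) : ℝ) : ℂ) * K u) μ) :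
    ∃ H : Hausdorff.L2 n →L[ℂ] Hausdorff.L2 n,
      Hausdorff.IsHausdorffOperator μ K A H ∧
      spectralRadius ℂ H = (‖H‖₊ : ENNReal) ∧
      (∃ C a, Hausdorff.Diagonalizes A C a) ∧
      ∀ (e : Fin (2 ^ n) ≃ (Fin n → ℤˣ)) (C : Matrix (Fin n) (Fin n) ℝ) (a : Ω → Fin n → ℝ),
        Hausdorff.Diagonalizes A C a →
        IsGreatest {r : ℝ | ∃ l : ℂ,
            (⨅ s : EuclideanSpace ℝ (Fin n),
              ‖(l • (1 : Matrix (Fin (2 ^ n)) (Fin (2 ^ n)) ℂ)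
                - Hausdorff.symbol μ K e a s).det‖) = 0 ∧ r = ‖l‖} ‖H‖ ∧
        IsLUB (Set.range fun s : EuclideanSpace ℝ (Fin n) =>
            ‖Matrix.toEuclideanCLM (n := Fin (2 ^ n)) (𝕜 := ℂ)
              (Hausdorff.symbol μ K e a s)‖) ‖H‖ := by
  have hadm : Hausdorff.IsAdmissible μ K A := ⟨hA_meas, hA_nonsing, hKA⟩
  -- A regular measure on a σ-compact space is σ-finite, which supplies the `SFinite` instance
  -- needed for Fubini.
  obtain ⟨H, hH⟩ := hadm.exists_operator
  have := hadm.isStarNormal hA_comm hH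
  refine ⟨H, hadm.isHausdorffOperator hH, IsStarNormal.spectralRadius_eq_nnnorm H,
    Hausdorff.exists_diagonalizes hA_comm hA_selfadj, fun e C a h => ?_⟩
  have hlub : IsLUB (Set.range fun s : EuclideanSpace ℝ (Fin n) =>
      ‖Matrix.toEuclideanCLM (n := Fin (2 ^ n)) (𝕜 := ℂ) (Hausdorff.symbol μ K e a s)‖) ‖H‖ := by
    constructor
    · rintro _ ⟨s, rfl⟩
      exact Hausdorff.norm_symbol_le_opNorm hadm h e hH s
    · exact fun M hM => Hausdorff.opNorm_le_of_norm_symbol_le hadm h e hH fun s => hM ⟨s, rfl⟩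
  exact ⟨Hausdorff.isGreatest_of_isLUB_norm (Hausdorff.isStarNormal_symbol e) hlub, hlub⟩
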